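/- Let $n=2r$ be even, let $S(n)$ be the compact spin group inside the Clifford algebra $C\ell_n$ (relations $e_ie_j+e_je_i=2\delta_{ij}$), and let $\mathcal S_n$ be the commutative $*$-Hopf algebra of complex polynomial functions on $S(n)$, with coproduct $\phi$ and counit $\epsilon$. Let $u_{ji}\in\mathcal S_n$ be the matrix elements of $u_g(x)=gxg^{-1}$ on $\mathbb C^n$, so $u_g(e_i)=\sum_j u_{ji}(g)e_j$. Let $e_{kl}=-e_{lk}$ be the canonical generators $E_{kl}-E_{lk}$ of $\mathfrak{so}(n)$, the Lie algebra of $S(n)$, and for $a\in\mathcal S_n$ write $e_{kl}\pi(a)=(e_{kl}a)(1)$ for the derivative of $a$ at the unit along the left-invariant vector field $e_{kl}$. Let $\mathcal B$ be a unital complex $*$-algebra and $F:\mathcal B\to\mathcal B\otimes\mathcal S_n$ a $*$-homomorphism that is a coaction, $(\mathrm{id}\otimes\phi)F=(F\otimes\mathrm{id})F$ and $(\mathrm{id}\otimes\epsilon)F=\mathrm{id}$, and is free: for every $a\in\mathcal S_n$ there are finitely many $q_i,b_i\in\mathcal B$ with $\sum_i q_iF(b_i)=1\otimes a$. Let $\mathcal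 V=\{b\in\mathcal B: F(b)=b\otimes 1\}$. Let $\partial_1,\dots,\partial_n:\mathcal V\to\mathcal B$ be hermitian derivations with $F\partial_i(f)=\sum_j\partial_j(f)\otimes u_{ji}$, for which there are $b_{i\alpha}\in\mathcal B$, $v_{i\alpha}\in\mathcal V$ (finitely many) with $\sum_\alpha b_{i\alpha}\partial_j(v_{i\alpha})=\delta_{ij}1$ (a frame structure), and let $X_1,\dots,X_n:\mathcal B\to\mathcal B$ be hermitian derivations extending the $\partial_i$ with $X_i\partial_j=X_j\partial_i$ on $\mathcal V$ and $FX_i(b)=\sum_{j,k}X_j(b_k)\otimes u_{ji}c_k$, where $F(b)=\sum_k b_k\otimes c_k$ (integrability). On horizontal forms $\mathfrak{hor}_P=\mathcal B\otimes\Lambda\mathbb C^n$ put $\nabla(b\otimes\vartheta)=\sum_kX_k(b)\otimes(e_k\wedge\vartheta)$ and, on $k$-forms, $\nabla^\dagger=-(-1)^{n-nk}\star\nabla\star$, where $\star$ is the ($\mathcal B$-linear) Hodge operator. The curvature is the linear map $\varrho:\mathcal S_n\to\mathfrak{hor}_P$ with $\nabla^2(b)=-\sum_kb_k\varrho(c_k)$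 for $b\in\mathcal B$, $F(b)=\sum_kb_k\otimes c_k$ (by freeness there is at most one such map). Assume that $\varrho$ is classical: $\varrho(ab)=\epsilon(a)\varrho(b)+\epsilon(b)\varrho(a)$ for all $a,b\in\mathcal S_n$. Let $\mathbb S=\Lambda V_+$ be the spinor space, where $V_\pm\subset\mathbb C^n$ are spanned by $e_{2j-1}\pm ie_{2j}$ ($1\le j\le r$), with Clifford action $x\xi=x_+\wedge\xi+x_-\lrcorner\,\xi$ for $x=(x_++x_-)/\sqrt2$, $x_\pm\in V_\pm$. Let $\gamma_i$ be the action of $e_i$, let $\sigma_I$ ($I\subseteq\{1,\dots,r\}$) be the basis of exterior products of the vectors $(e_{2j-1}+ie_{2j})/\sqrt2$, and let $U$ be the restriction of the Clifford action to $S(n)$, with matrix elements $U_{JI}\in\mathcal S_n$, $U_g\sigma_I=\sum_JU_{JI}(g)\sigma_J$. Let $\mathcal E$ be the space of $\psi=\sum_I\psi_I\otimes\sigma_I\in\mathcal B\otimes\mathbb S$ that are invariant under the product of the actions $F$ and $U$ of $S(n)$. Put $$D_E(\psi)=-i\sum_{i,I}X_i(\psi_I)\otimes\gamma_i\sigma_I,\qquad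 \Delta_E=\nabla_E\nabla_E^\dagger+\nabla_E^\dagger\nabla_E,$$ where $\nabla_E=\nabla\otimes\mathrm{id}_{\mathbb S}$ and $\nabla_E^\dagger=\nabla^\dagger\otimes\mathrm{id}_{\mathbb S}$. Then $\varrho(a)=\frac12\sum_{i,j}\varrho_{ij}(a)\otimes(e_i\wedge e_j)$ with components $\varrho_{ij}=-\varrho_{ji}:\mathcal S_n\to\mathcal B$, and there is exactly one family $\varrho_{ijkl}\in\mathcal B$, antisymmetric in $k,l$, such that $$\varrho_{ij}(a)=\tfrac12\sum_{k,l}\varrho_{ijkl}\,e_{kl}\pi(a)\qquad(a\in\mathcal S_n).$$ All $\varrho_{ijkl}$ belong to the center of $\mathcal B$. With $\rho=\sum_{i,j}\varrho_{ijij}$, the curvature operator $$\varrho_E(\psi)=-\tfrac12\sum_{i,j,I,J}\psi_I\,\varrho_{ij}(U_{JI})\otimes\gamma_i\gamma_j\sigma_J$$ satisfies $\varrho_E(\psi)=\frac14\rho\,\psi$ for every $\psi\in\mathcal E$, and the Lichnerowicz formula $D_E^2\psi=\Delta_E\psi+\frac14\rho\,\psi$ holds for every $\psi\in\mathcal E$.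 -/

import Mathlib

open scoped TensorProduct

noncomputable section

namespace QSpin

/-! ### The spin group and its algebra of polynomial functions -/

/-- The Euclidean quadratic form `x ↦ ∑ xᵢ²` on `ℝⁿ`; the Clifford relations are
`eᵢ eⱼ + eⱼ eᵢ = 2 δᵢⱼ`. -/
abbrev euclForm (n : ℕ) : QuadraticForm ℝ (Fin n → ℝ) :=
  QuadraticMap.weightedSumSquares ℝ (fun _ : Fin n => (1 : ℝ))

/-- The real Clifford algebra; `Cℓₙ` is its complexification. -/
abbrev Cl (n : ℕ) : Type := CliffordAlgebra (euclForm n)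

/-- The basis vector `eᵢ` in the Clifford algebra. -/
def clE {n : ℕ} (i : Fin n) : Cl n := CliffordAlgebra.ι (euclForm n) (Pi.single i 1)

/-- The compact spin group `S(n)`. -/
abbrev SpinG (n : ℕ) : Type := spinGroup (euclForm n)

/-- The commutative *-algebra `𝒮ₙ` of complex polynomial functions on `S(n) ⊆ Cℓₙ`, that is, the
*-algebra of functions generated by the restrictions of the linear functionals. -/
def polyFun (n : ℕ) : StarSubalgebra ℂ (SpinG n → ℂ) :=
  StarAlgebra.adjoin ℂ {f | ∃ φ : Cl n →ₗ[ℝ] ℂ, f = fun g : SpinG n => φ (g : Cl n)}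

/-- `𝒮ₙ` as a type. -/
abbrev Pol (n : ℕ) : Type := polyFun n

/-- Evaluation at a group element, a character of `𝒮ₙ`. The counit is `ev 1`. -/
def ev {n : ℕ} (g : SpinG n) : Pol n →ₐ[ℂ] ℂ :=
  (Pi.evalAlgHom ℂ (fun _ : SpinG n => ℂ) g).comp (polyFun n).subtype.toAlgHom

/-- The counit `ε` of `𝒮ₙ`. -/
abbrev counit {n : ℕ} : Pol n →ₐ[ℂ] ℂ := ev (1 : SpinG n)

theorem linear_mem_polyFun {n : ℕ} (φ : Cl n →ₗ[ℝ] ℂ) :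
    (fun g : SpinG n => φ (g : Cl n)) ∈ polyFun n :=
  StarAlgebra.subset_adjoin ℂ _ ⟨φ, rfl⟩

instance finite_Cl (n : ℕ) : Module.Finite ℝ (Cl n) :=
  have : Module.Finite ℝ (ExteriorAlgebra ℝ (Fin n → ℝ)) :=
    Module.Finite.of_basis (Pi.basisFun ℝ (Fin n)).ExteriorAlgebra
  Module.Finite.equiv (CliffordAlgebra.equivExterior (euclForm n)).symm

theorem bilinear_mem_polyFun {n : ℕ} (β : Cl n →ₗ[ℝ] Cl n →ₗ[ℝ] ℂ) :
    (fun g : SpinG n => β (g : Cl n) (g : Cl n)) ∈ polyFun n := by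
  classical
  let b := Module.finBasis ℝ (Cl n)
  have h : (fun g : SpinG n => β (g : Cl n) (g : Cl n)) =
      ∑ p, ∑ q, β (b p) (b q) •
        ((fun g : SpinG n => (Complex.ofRealLI.toLinearMap ∘ₗ b.coord p) (g : Cl n)) *
         (fun g : SpinG n => (Complex.ofRealLI.toLinearMap ∘ₗ b.coord q) (g : Cl n))) := by
    funext g
    rw [← LinearMap.sum_repr_mul_repr_mul b b,
      Finsupp.sum_fintype _ _ (fun i => by simp [Finsupp.sum]), Finset.sum_apply]
    refine Finset.sum_congr rfl fun p _ => ?_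
    rw [Finsupp.sum_fintype _ _ (fun i => by simp), Finset.sum_apply]
    refine Finset.sum_congr rfl fun q _ => ?_
    simp only [Pi.smul_apply, Pi.mul_apply, LinearMap.comp_apply, Module.Basis.coord_apply,
      smul_eq_mul, Complex.real_smul]
    change _ = β (b p) (b q) * (((b.repr (g : Cl n) p : ℝ) : ℂ) * ((b.repr (g : Cl n) q : ℝ) : ℂ))
    ring
  rw [h]
  exact sum_mem fun p _ => sum_mem fun q _ => SMulMemClass.smul_mem _
    (mul_mem (linear_mem_polyFun _) (linear_mem_polyFun _))

/-- The vector part of an element of the Clifford algebra. -/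
def vecPart (n : ℕ) : Cl n →ₗ[ℝ] (Fin n → ℝ) :=
  ExteriorAlgebra.ιInv ∘ₗ (CliffordAlgebra.equivExterior (euclForm n)).toLinearMap

/-- The matrix element `uⱼᵢ ∈ 𝒮ₙ` of the vector representation `u_g(x) = g x g⁻¹`
(recall `g⁻¹ = star g` on `S(n)`), so that `u_g(eᵢ) = ∑ⱼ uⱼᵢ(g) eⱼ`. -/
def vecRep {n : ℕ} (j i : Fin n) : Pol n :=
  ⟨fun g => ((vecPart n ((g : Cl n) * clE i * star (g : Cl n)) j : ℝ) : ℂ), by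
    let β : Cl n →ₗ[ℝ] Cl n →ₗ[ℝ] ℂ := LinearMap.mk₂ ℝ
      (fun x y => ((vecPart n (x * clE i * star y) j : ℝ) : ℂ))
      (by intros; simp [add_mul]) (by intros; simp)
      (by intros; simp [mul_add]) (by intros; simp [CliffordAlgebra.star_smul])
    exact bilinear_mem_polyFun β⟩

theorem clE_sq {n : ℕ} (v : Fin n → ℝ) :
    CliffordAlgebra.ι (euclForm n) v * CliffordAlgebra.ι (euclForm n) v =
      algebraMap ℝ (Cl n) (∑ i, v i * v i) := by
  rw [CliffordAlgebra.ι_sq_scalar]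
  simp [QuadraticMap.weightedSumSquares_apply]

theorem mul_unit_vectors_mem {n : ℕ} (v w : Fin n → ℝ)
    (hv : ∑ i, v i * v i = 1) (hw : ∑ i, w i * w i = 1) :
    CliffordAlgebra.ι (euclForm n) v * CliffordAlgebra.ι (euclForm n) w ∈
      spinGroup (euclForm n) := by
  have hv' := clE_sq v
  have hw' := clE_sq w
  rw [hv, map_one] at hv'
  rw [hw, map_one] at hw'
  refine ⟨⟨?_, ?_⟩, CliffordAlgebra.ι_mul_ι_mem_evenOdd_zero _ v w⟩
  · let V : (Cl n)ˣ := ⟨_, _, hv', hv'⟩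
    let W : (Cl n)ˣ := ⟨_, _, hw', hw'⟩
    refine ⟨V * W, mul_mem (Subgroup.subset_closure ⟨v, rfl⟩) (Subgroup.subset_closure ⟨w, rfl⟩),
      rfl⟩
  · change _ ∈ unitary (Cl n)
    rw [Unitary.mem_iff]
    simp only [star_mul, CliffordAlgebra.star_ι]
    constructor
    · rw [neg_mul_neg, mul_assoc, ← mul_assoc _ _ (CliffordAlgebra.ι (euclForm n) w), hv',
        one_mul, hw']
    · rw [neg_mul_neg, mul_assoc, ← mul_assoc _ _ (CliffordAlgebra.ι (euclForm n) v), hw',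
        one_mul, hv']

/-- The one-parameter subgroup `exp(t e_kl) = exp(t eₖ eₗ / 2) = cos(t/2) + sin(t/2) eₖ eₗ`
(`k ≠ l`) of `S(n)` generated by the canonical generator `e_kl = E_kl - E_lk` of `so(n)`;
`e_kk = 0`. -/
def rot {n : ℕ} (k l : Fin n) (t : ℝ) : SpinG n :=
  if h : k = l then 1 else
  ⟨algebraMap ℝ (Cl n) (Real.cos (t / 2)) + Real.sin (t / 2) • (clE k * clE l), by
    have := mul_unit_vectors_mem (Pi.single k (1 : ℝ))
      (Real.cos (t / 2) • Pi.single k (1 : ℝ) + Real.sin (t / 2) • Pi.single l (1 : ℝ))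
      (by simp [Pi.single_apply])
      (by
        have h' : ∀ i : Fin n,
            (Real.cos (t / 2) • Pi.single k (1 : ℝ) +
              Real.sin (t / 2) • Pi.single l (1 : ℝ) : Fin n → ℝ) i *
            (Real.cos (t / 2) • Pi.single k (1 : ℝ) +
              Real.sin (t / 2) • Pi.single l (1 : ℝ) : Fin n → ℝ) i =
            (if i = k then Real.cos (t / 2) ^ 2 else 0) +
              (if i = l then Real.sin (t / 2) ^ 2 else 0) := by
          intro i
          by_cases h1 : i = k
          · subst h1
            simp [h, pow_two]
          · by_cases h2 : i = l
            · subst h2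
              simp [h1, pow_two]
            · simp [h1, h2]
        simp_rw [h', Finset.sum_add_distrib]
        simp)
    have e : CliffordAlgebra.ι (euclForm n) (Pi.single k (1 : ℝ)) *
        CliffordAlgebra.ι (euclForm n)
        (Real.cos (t / 2) • Pi.single k (1 : ℝ) + Real.sin (t / 2) • Pi.single l (1 : ℝ)) =
        algebraMap ℝ (Cl n) (Real.cos (t / 2)) + Real.sin (t / 2) • (clE k * clE l) := by
      rw [map_add, map_smul, map_smul, mul_add, mul_smul_comm, mul_smul_comm, clE_sq]
      simp [clE, Pi.single_apply, Algebra.smul_def]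
    rwa [e] at this⟩

/-- `e_kl π(a) = π(a)(e_kl) = (e_kl a)(1)`: the derivative of `a` at the unit along the
left-invariant vector field of `e_kl ∈ so(n)`. -/
def genPi {n : ℕ} (k l : Fin n) (a : Pol n) : ℂ :=
  deriv (fun t : ℝ => ev (rot k l t) a) 0

/-! ### Quantum principal spin bundles and frame structures -/

section Bundle

variable {n : ℕ} {B : Type*} [Ring B] [StarRing B] [Algebra ℂ B] [StarModule ℂ B]

/-- Apply a linear functional to the second tensor factor. -/
def slice {M : Type*} [AddCommGroup M] [Module ℂ M] (f : M →ₗ[ℂ] ℂ) : B ⊗[ℂ] M →ₗ[ℂ] B :=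
  (TensorProduct.rid ℂ B).toLinearMap ∘ₗ LinearMap.lTensor B f

variable (n B) in
/-- A quantum principal `S(n)`-bundle with total space `B`. The comodule axioms for the dualized
action `F` are written on points of `S(n)`: with `F_g = (id ⊗ g) F`, coassociativity is
`F_{gh} = F_g F_h` and counitality is `F_1 = id`. -/
structure SpinBundle where
  /-- the dualized right action -/
  F : B →⋆ₐ[ℂ] B ⊗[ℂ] Pol n
  coassoc : ∀ (g h : SpinG n) (b : B),
    slice (ev (g * h)).toLinearMap (F b) =
      slice (ev g).toLinearMap (F (slice (ev h).toLinearMap (F b)))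
  counital : ∀ b : B, slice (counit (n := n)).toLinearMap (F b) = b
  free : ∀ a : Pol n, ∃ (m : ℕ) (q b : Fin m → B),
    ∑ i, (q i ⊗ₜ[ℂ] (1 : Pol n)) * F (b i) = 1 ⊗ₜ[ℂ] a

/-- The automorphism `F_g = (id ⊗ g) F` of `B`. -/
def SpinBundle.act (P : SpinBundle n B) (g : SpinG n) : B →ₗ[ℂ] B :=
  slice (ev g).toLinearMap ∘ₗ P.F.toAlgHom.toLinearMap

/-- The *-algebra `𝒱` of functions on the base: the `F`-invariant elements. -/
def SpinBundle.base (P : SpinBundle n B) : StarSubalgebra ℂ B where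
  carrier := {b | P.F b = b ⊗ₜ[ℂ] (1 : Pol n)}
  mul_mem' := by
    intro a b ha hb
    simp only [Set.mem_ofPred_eq] at *
    rw [map_mul, ha, hb, Algebra.TensorProduct.tmul_mul_tmul, one_mul]
  add_mem' := by
    intro a b ha hb
    simp only [Set.mem_ofPred_eq] at *
    rw [map_add, ha, hb, TensorProduct.add_tmul]
  algebraMap_mem' := by
    intro c
    simp only [Set.mem_ofPred_eq]
    rw [AlgHomClass.commutes, Algebra.TensorProduct.algebraMap_apply]
  star_mem' := by
    intro a ha
    simp only [Set.mem_ofPred_eq] at *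
    rw [map_star, ha, TensorProduct.star_tmul, star_one]

/-- A frame structure `τ = (∂₁, …, ∂ₙ)`. -/
structure FrameStructure (P : SpinBundle n B) where
  /-- the derivations `∂ᵢ : 𝒱 → B` -/
  d : Fin n → P.base →ₗ[ℂ] B
  leibniz : ∀ i (f h : P.base), d i (f * h) = d i f * h + f * d i h
  hermitian : ∀ i (f : P.base), d i (star f) = star (d i f)
  covariant : ∀ i (f : P.base), P.F (d i f) = ∑ j, d j f ⊗ₜ[ℂ] vecRep j i
  nondegenerate : ∃ (m : ℕ) (b : Fin n → Fin m → B) (v : Fin n → Fin m → P.base),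
    ∀ i j, ∑ α, b i α * d j (v i α) = if i = j then 1 else 0

/-- A system `(X₁, …, Xₙ)` exhibiting the frame structure `τ` as integrable. -/
structure IntegrableSystem {P : SpinBundle n B} (τ : FrameStructure P) where
  /-- the derivations `Xᵢ : B → B` -/
  X : Fin n → B →ₗ[ℂ] B
  leibniz : ∀ i (b c : B), X i (b * c) = X i b * c + b * X i c
  hermitian : ∀ i (b : B), X i (star b) = star (X i b)
  extends_d : ∀ i (f : P.base), X i f = τ.d i f
  torsionFree : ∀ i j (f : P.base), X i (τ.d j f) - X j (τ.d i f) = 0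
  covariant : ∀ i (b : B), P.F (X i b) =
    ∑ j, TensorProduct.map (X j) (LinearMap.mulLeft ℂ (vecRep j i)) (P.F b)

/-! ### Horizontal forms, covariant derivative, Hodge operator -/

variable (n) in
/-- The exterior algebra `ℂₙ^∧`. -/
abbrev Ext : Type := ExteriorAlgebra ℂ (Fin n → ℂ)

/-- The generator `eᵢ` of the exterior algebra. -/
def extE (i : Fin n) : Ext n := ExteriorAlgebra.ι ℂ (Pi.single i 1)

variable (n B) in
/-- The algebra `hor_P = B ⊗ ℂₙ^∧` of horizontal forms. -/
abbrev Hor := B ⊗[ℂ] Ext n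

/-- `∇(b ⊗ ϑ) = ∑ₖ Xₖ(b) ⊗ (eₖ ∧ ϑ)`. -/
def nabla (X : Fin n → B →ₗ[ℂ] B) : Hor n B →ₗ[ℂ] Hor n B :=
  ∑ k, TensorProduct.map (X k) (LinearMap.mulLeft ℂ (extE k))

/-- The linear functional `y ↦ ∑ᵢ xᵢ yᵢ` on `ℂᵐ`. -/
def dualVec {m : ℕ} (x : Fin m → ℂ) : Module.Dual ℂ (Fin m → ℂ) :=
  ∑ i, x i • LinearMap.proj i

/-- Contraction of the exterior algebra by vectors, extended to multivectors by
`(x₁ ∧ ⋯ ∧ xₖ) ⌟ ω = x₁ ⌟ (x₂ ⌟ ⋯ (xₖ ⌟ ω))`. -/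
def contraction (n : ℕ) : Ext n →ₐ[ℂ] Module.End ℂ (Ext n) :=
  ExteriorAlgebra.lift ℂ
    ⟨{ toFun := fun x => CliffordAlgebra.contractLeft (dualVec x)
       map_add' := by
        intro x y
        rw [← map_add]
        simp [dualVec, add_smul, Finset.sum_add_distrib]
       map_smul' := by
        intro c x
        rw [RingHom.id_apply, ← map_smul]
        simp [dualVec, Finset.smul_sum, mul_smul] },
     by
      intro x
      ext y
      exact CliffordAlgebra.contractLeft_contractLeft _ _⟩

/-- The volume element `e₁ ∧ ⋯ ∧ eₙ`. -/
def vol (n : ℕ) : Ext n := ExteriorAlgebra.ιMulti ℂ n (fun i => Pi.single i 1)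

/-- The Hodge operator on `ℂₙ^∧`: it sends `e_{i₁} ∧ ⋯ ∧ e_{iₖ}` to
`e_{iₖ} ⌟ (⋯ (e_{i₁} ⌟ vol))`, which is `± e_{j₁} ∧ ⋯ ∧ e_{jₗ}` (complementary indices) with the
sign for which `(e_{i₁} ∧ ⋯ ∧ e_{iₖ}) ∧ (± e_{j₁} ∧ ⋯ ∧ e_{jₗ}) = e₁ ∧ ⋯ ∧ eₙ`. -/
def hodgeExt (n : ℕ) : Ext n →ₗ[ℂ] Ext n :=
  LinearMap.applyₗ (vol n) ∘ₗ (contraction n).toLinearMap ∘ₗ CliffordAlgebra.reverse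

variable (n B) in
/-- The Hodge operator on `hor_P`. -/
def hodge : Hor n B →ₗ[ℂ] Hor n B := LinearMap.lTensor B (hodgeExt n)

variable (n B) in
/-- The grading operator on `hor_P`, equal to `(-1)ᵏ` on `k`-forms. -/
def parity : Hor n B →ₗ[ℂ] Hor n B :=
  LinearMap.lTensor B (CliffordAlgebra.involute : Ext n →ₐ[ℂ] Ext n).toLinearMap

/-- `∇† = -(-1)^{n - nk} ⋆ ∇ ⋆` on `k`-forms. -/
def nablaDag (X : Fin n → B →ₗ[ℂ] B) : Hor n B →ₗ[ℂ] Hor n B :=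
  (-(-1 : ℂ) ^ n) • (hodge n B ∘ₗ nabla X ∘ₗ hodge n B ∘ₗ (parity n B) ^ n)

/-! ### Curvature -/

/-- The map `b ⊗ a ↦ b ϱ(a)`. -/
def mulBy (ϱ : Pol n →ₗ[ℂ] Hor n B) : B ⊗[ℂ] Pol n →ₗ[ℂ] Hor n B :=
  LinearMap.mul' ℂ (Hor n B) ∘ₗ
    TensorProduct.map (Algebra.TensorProduct.includeLeft : B →ₐ[ℂ] Hor n B).toLinearMap ϱ

/-- `ϱ` is the curvature tensor: `∇²(b) = - ∑ₖ bₖ ϱ(cₖ)` where `F(b) = ∑ₖ bₖ ⊗ cₖ`. By freeness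
of the action, this identity on functions `b ∈ B` determines `ϱ`. -/
def IsCurvature (P : SpinBundle n B) (X : Fin n → B →ₗ[ℂ] B) (ϱ : Pol n →ₗ[ℂ] Hor n B) : Prop :=
  ∀ b : B, nabla X (nabla X (b ⊗ₜ[ℂ] 1)) = - mulBy ϱ (P.F b)

/-- The curvature is classical: `ϱ(ab) = ε(a) ϱ(b) + ε(b) ϱ(a)`. -/
def IsClassical (ϱ : Pol n →ₗ[ℂ] Hor n B) : Prop :=
  ∀ a b : Pol n, ϱ (a * b) = counit a • ϱ b + counit b • ϱ a

/-- The coefficient functional of `eᵢ ∧ eⱼ` on the exterior algebra (zero for `i = j`, antisymmetric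
in `i` and `j`). -/
def coeff₂ (i j : Fin n) : Ext n →ₗ[ℂ] ℂ :=
  (ExteriorAlgebra.algebraMapInv (R := ℂ) (M := Fin n → ℂ)).toLinearMap ∘ₗ
    CliffordAlgebra.contractLeft (LinearMap.proj j) ∘ₗ
    CliffordAlgebra.contractLeft (LinearMap.proj i)

/-- The component `ϱᵢⱼ : 𝒮ₙ → B` in `ϱ(a) = (1/2) ∑ᵢⱼ ϱᵢⱼ(a) ⊗ (eᵢ ∧ eⱼ)`, `ϱⱼᵢ = -ϱᵢⱼ`. -/
def curvComp (ϱ : Pol n →ₗ[ℂ] Hor n B) (i j : Fin n) : Pol n →ₗ[ℂ] B :=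
  slice (coeff₂ i j) ∘ₗ ϱ

/-- `R` is the family of coefficients `ϱᵢⱼₖₗ` of the curvature with respect to the generators
`e_kl = -e_lk`: antisymmetric in `k, l`, with `ϱᵢⱼ(a) = (1/2) ∑ₖₗ ϱᵢⱼₖₗ e_kl π(a)`. -/
def IsCurvCoeff (ϱ : Pol n →ₗ[ℂ] Hor n B) (R : Fin n → Fin n → Fin n → Fin n → B) : Prop :=
  (∀ i j k l, R i j l k = - R i j k l) ∧
  ∀ i j a, curvComp ϱ i j a = (1 / 2 : ℂ) • ∑ k, ∑ l, genPi k l a • R i j k l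

/-- The scalar curvature `ρ = ∑ᵢⱼ ϱᵢⱼᵢⱼ`. -/
def scalarCurv (R : Fin n → Fin n → Fin n → Fin n → B) : B := ∑ i, ∑ j, R i j i j

end Bundle

/-! ### Spinors, for `n = 2r` -/

/-- The space `V₊^∧` of algebraic spinors, where `V₊` is identified with `ℂʳ` through its basis
`(e_{2j-1} + i e_{2j}) / √2`, `j = 1, …, r`. -/
abbrev Spinor (r : ℕ) : Type := ExteriorAlgebra ℂ (Fin r → ℂ)

/-- The basis `σ_I` of the spinor space: exterior products, in increasing order, of the basis
vectors of `V₊` with index in `I`. -/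
def sig (r : ℕ) : Module.Basis (Finset (Fin r)) ℂ (Spinor r) :=
  (Pi.basisFun ℂ (Fin r)).ExteriorAlgebra

/-- With 0-based indices, position `2j` of `Fin (2 * r)`. -/
def idxE {r : ℕ} (j : Fin r) : Fin (2 * r) := ⟨2 * j, by omega⟩

/-- With 0-based indices, position `2j + 1` of `Fin (2 * r)`. -/
def idxO {r : ℕ} (j : Fin r) : Fin (2 * r) := ⟨2 * j + 1, by omega⟩

/-- For a real vector `x = (x₊ + x₋) / √2`, the coordinates of `x₊` in the basis
`(e_{2j-1} + i e_{2j}) / √2` of `V₊`. -/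
def plusPart (r : ℕ) : (Fin (2 * r) → ℝ) →ₗ[ℝ] (Fin r → ℂ) where
  toFun x j := (x (idxE j) : ℂ) - Complex.I * x (idxO j)
  map_add' x y := by funext j; simp; ring
  map_smul' c x := by funext j; simp; ring

/-- For a real vector `x = (x₊ + x₋) / √2`, the coordinates of `x₋` in the basis
`(e_{2j-1} - i e_{2j}) / √2` of `V₋`, which is dual to the basis of `V₊`. -/
def minusPart (r : ℕ) : (Fin (2 * r) → ℝ) →ₗ[ℝ] (Fin r → ℂ) where
  toFun x j := (x (idxE j) : ℂ) + Complex.I * x (idxO j)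
  map_add' x y := by funext j; simp; ring
  map_smul' c x := by funext j; simp; ring

/-- The Clifford action `x ξ = x₊ ∧ ξ + x₋ ⌟ ξ` of vectors on spinors. -/
def gammaVec (r : ℕ) : (Fin (2 * r) → ℝ) →ₗ[ℝ] Module.End ℂ (Spinor r) where
  toFun x := LinearMap.mulLeft ℂ (ExteriorAlgebra.ι ℂ (plusPart r x)) +
    CliffordAlgebra.contractLeft (dualVec (minusPart r x))
  map_add' x y := by
    ext ξ
    simp [dualVec, add_smul, Finset.sum_add_distrib, add_mul]
    abel
  map_smul' c x := by
    refine LinearMap.ext fun ξ => ?_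
    have h₁ : plusPart r (c • x) = (c : ℂ) • plusPart r x := by
      rw [map_smul]; exact (algebraMap_smul ℂ c (plusPart r x)).symm
    have h₂ : dualVec (minusPart r (c • x)) = (c : ℂ) • dualVec (minusPart r x) := by
      rw [map_smul]; simp [dualVec, Finset.smul_sum, mul_smul]
    change ExteriorAlgebra.ι ℂ (plusPart r (c • x)) * ξ +
        CliffordAlgebra.contractLeft (dualVec (minusPart r (c • x))) ξ =
      c • (ExteriorAlgebra.ι ℂ (plusPart r x) * ξ +
        CliffordAlgebra.contractLeft (dualVec (minusPart r x)) ξ)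
    rw [h₁, h₂, map_smul, map_smul, smul_mul_assoc, LinearMap.smul_apply, ← smul_add]
    exact algebraMap_smul ℂ c _

theorem sum_idx {r : ℕ} (f : Fin (2 * r) → ℝ) :
    ∑ i, f i = ∑ j : Fin r, (f (idxE j) + f (idxO j)) := by
  rw [← (finProdFinEquiv.trans (finCongr (mul_comm r 2))).sum_comp f, Fintype.sum_prod_type]
  refine Finset.sum_congr rfl fun j _ => ?_
  rw [Fin.sum_univ_two]
  congr 2 <;> ext <;> simp [idxE, idxO, finProdFinEquiv]; omega

theorem gammaVec_sq (r : ℕ) (x : Fin (2 * r) → ℝ) :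
    gammaVec r x * gammaVec r x = algebraMap ℝ _ (euclForm (2 * r) x) := by
  have h : dualVec (minusPart r x) (plusPart r x) = ((euclForm (2 * r) x : ℝ) : ℂ) := by
    rw [QuadraticMap.weightedSumSquares_apply, sum_idx]
    simp only [dualVec, LinearMap.sum_apply, LinearMap.smul_apply, LinearMap.proj_apply,
      minusPart, plusPart, LinearMap.coe_mk, AddHom.coe_mk, smul_eq_mul, one_mul]
    push_cast
    refine Finset.sum_congr rfl fun j _ => ?_
    linear_combination (-(x (idxO j) : ℂ) ^ 2) * Complex.I_sq
  refine LinearMap.ext fun ξ => ?_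
  change ExteriorAlgebra.ι ℂ (plusPart r x) * (ExteriorAlgebra.ι ℂ (plusPart r x) * ξ +
      CliffordAlgebra.contractLeft (dualVec (minusPart r x)) ξ) +
    CliffordAlgebra.contractLeft (dualVec (minusPart r x))
      (ExteriorAlgebra.ι ℂ (plusPart r x) * ξ +
        CliffordAlgebra.contractLeft (dualVec (minusPart r x)) ξ) = _
  rw [map_add, CliffordAlgebra.contractLeft_contractLeft, mul_add, ← mul_assoc,
    ExteriorAlgebra.ι_sq_zero]
  erw [CliffordAlgebra.contractLeft_ι_mul]
  rw [h, zero_mul, zero_add, add_zero, add_sub_cancel, Algebra.algebraMap_eq_smul_one]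
  exact algebraMap_smul ℂ (euclForm (2 * r) x) ξ

/-- The action of the Clifford algebra on spinors; restricted to `S(n)` it is the spin
representation `U`. -/
def cliffAct (r : ℕ) : Cl (2 * r) →ₐ[ℝ] Module.End ℂ (Spinor r) :=
  CliffordAlgebra.lift (euclForm (2 * r)) ⟨gammaVec r, gammaVec_sq r⟩

/-- The operator `γᵢ`. -/
def gam {r : ℕ} (i : Fin (2 * r)) : Module.End ℂ (Spinor r) := cliffAct r (clE i)

/-- The matrix element `U_JI ∈ 𝒮ₙ` of the spin representation, `U_g(σ_I) = ∑_J U_JI(g) σ_J`. -/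
def spinRep {r : ℕ} (J I : Finset (Fin r)) : Pol (2 * r) :=
  ⟨fun g => (sig r).coord J (cliffAct r (g : Cl (2 * r)) (sig r I)),
    linear_mem_polyFun
      { toFun := fun x => (sig r).coord J (cliffAct r x (sig r I))
        map_add' := by intro x y; simp
        map_smul' := by intro c x; simp }⟩

section Fields

variable {r : ℕ} {B : Type*} [Ring B] [StarRing B] [Algebra ℂ B] [StarModule ℂ B]

/-- The space `𝓔` of spinor fields: the elements of `B ⊗ V₊^∧` invariant under the product of the
actions `F` and `U` of `S(n)`. -/
def spinorFields (P : SpinBundle (2 * r) B) : Submodule ℂ (B ⊗[ℂ] Spinor r) where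
  carrier := {ψ | ∀ g : SpinG (2 * r),
    TensorProduct.map (P.act g) (cliffAct r (g : Cl (2 * r))) ψ = ψ}
  add_mem' := by
    intro a b ha hb g
    rw [map_add, ha g, hb g]
  zero_mem' := by
    intro g
    rw [map_zero]
  smul_mem' := by
    intro c a ha g
    rw [map_smul, ha g]

/-- The Dirac operator `D_E(ψ) = -i ∑ᵢ_I Xᵢ(ψ_I) ⊗ γᵢ σ_I`. -/
def dirac (X : Fin (2 * r) → B →ₗ[ℂ] B) : B ⊗[ℂ] Spinor r →ₗ[ℂ] B ⊗[ℂ] Spinor r :=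
  (-Complex.I) • ∑ i, TensorProduct.map (X i) (gam i)

/-- The Laplacian `Δ_E = ∇_E ∇_E† + ∇_E† ∇_E`, on `hor_P ⊗ V₊^∧`. -/
def laplacian (X : Fin (2 * r) → B →ₗ[ℂ] B) :
    Hor (2 * r) B ⊗[ℂ] Spinor r →ₗ[ℂ] Hor (2 * r) B ⊗[ℂ] Spinor r :=
  LinearMap.rTensor (Spinor r) (nabla X) ∘ₗ LinearMap.rTensor (Spinor r) (nablaDag X) +
    LinearMap.rTensor (Spinor r) (nablaDag X) ∘ₗ LinearMap.rTensor (Spinor r) (nabla X)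

/-- The inclusion `B ⊗ V₊^∧ ⊆ hor_P ⊗ V₊^∧` in form degree zero. -/
def degZero : B ⊗[ℂ] Spinor r →ₗ[ℂ] Hor (2 * r) B ⊗[ℂ] Spinor r :=
  LinearMap.rTensor (Spinor r)
    (Algebra.TensorProduct.includeLeft : B →ₐ[ℂ] Hor (2 * r) B).toLinearMap

/-- The curvature operator
`ϱ_E(ψ) = -(1/2) ∑ᵢⱼ_IJ ψ_I ϱᵢⱼ(U_JI) ⊗ γᵢ γⱼ σ_J`, where `ψ = ∑_I ψ_I ⊗ σ_I`. -/
def curvOp (ϱ : Pol (2 * r) →ₗ[ℂ] Hor (2 * r) B) (ψ : B ⊗[ℂ] Spinor r) : B ⊗[ℂ] Spinor r :=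
  (-(1 / 2) : ℂ) • ∑ i, ∑ j, ∑ I : Finset (Fin r), ∑ J : Finset (Fin r),
    (slice ((sig r).coord I) ψ * curvComp ϱ i j (spinRep J I)) ⊗ₜ[ℂ] gam i (gam j (sig r J))

end Fields

end QSpin

end

noncomputable section

namespace QSpin

/-! ### Monomials in the Clifford algebra -/

section Clifford

variable {n : ℕ}

/-! A derivation of `Pol n` at the unit is determined by its values on the matrix elements u_kl of
the vector representation (`IsPointDerivation.eq_zero`), so it is a combination of the e_kl
(`IsPointDerivation.eq_sum_genPi`). Classicality says exactly that each component ϱ_ij of the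
curvature is such a derivation; hence the coefficients exist, are unique, and are ϱ_ijkl =
ϱ_ij(u_kl).

Comparing coefficients in ∇² expresses [X_i, X_j] through ϱ_ij and F (`IsCurvature.commutator`).
Since a commutator of derivations is a derivation, freeness forces the values of ϱ_ij into the
center (`IsCurvature.comm`). Torsion-freeness and the frame give the first Bianchi identity
(`IsCurvature.bianchi`), which collapses ∑ ϱ_ijkl γ_i γ_j γ_k γ_l to -2ρ
(`sum_tmul_gamma_of_bianchi`); centrality then moves ρ to the left of the components of ψ.

The Clifford relations split D² into -∑ X_i² and a sum over commutators (`dirac_dirac`). The first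
is the Laplacian on functions (`laplacian_degZero`). The second is the curvature operator, because
invariance of ψ replaces the action F on components by the spin representation
(`mulComp_spinorField`). -/

theorem clE_mul_self (i : Fin n) : clE i * clE i = 1 := by
  rw [clE, clE_sq]
  simp [Pi.single_apply]

theorem clE_mul_add_swap (i j : Fin n) :
    clE i * clE j + clE j * clE i = algebraMap ℝ (Cl n) (if i = j then 2 else 0) := by
  rw [clE, clE, CliffordAlgebra.ι_mul_ι_add_swap]
  congr 1
  simp only [QuadraticMap.polar, QuadraticMap.weightedSumSquares_apply]
  by_cases h : i = j
  · subst h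
    simp [Pi.single_apply, mul_add, Finset.sum_add_distrib]
    norm_num
  · have h' : ¬ j = i := fun e => h e.symm
    simp [Pi.single_apply, mul_add, Finset.sum_add_distrib, h, h']

theorem clE_mul_of_ne {i j : Fin n} (h : i ≠ j) : clE i * clE j = -(clE j * clE i) := by
  have := clE_mul_add_swap i j
  rw [if_neg h, map_zero] at this
  exact eq_neg_of_add_eq_zero_left this

theorem ι_eq_sum_clE (v : Fin n → ℝ) :
    CliffordAlgebra.ι (euclForm n) v = ∑ i, v i • clE i := by
  conv_lhs => rw [pi_eq_sum_univ' v]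
  rw [map_sum]
  refine Finset.sum_congr rfl fun i _ => ?_
  rw [map_smul, clE]

/-- The monomial `e_{i₁} ⋯ e_{iₖ}` in the Clifford algebra. -/
def mono (l : List (Fin n)) : Cl n := (l.map clE).prod

@[simp] theorem mono_nil : mono ([] : List (Fin n)) = 1 := rfl

@[simp] theorem mono_cons (i : Fin n) (l : List (Fin n)) : mono (i :: l) = clE i * mono l := by
  simp [mono]

/-- Each letter other than i contributes a sign. The exponent uses length + count in place of length
- count: it has the same parity and avoids subtraction in ℕ. -/
theorem clE_mul_mono (i : Fin n) (l : List (Fin n)) :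
    clE i * mono l = (-1 : ℝ) ^ (l.length + l.count i) • (mono l * clE i) := by
  induction l with
  | nil => simp
  | cons j l ih =>
    by_cases h : j = i
    · subst h
      rw [mono_cons, mul_assoc (clE j) (mono l), ← mul_smul_comm]
      congr 1
      rw [ih]
      simp only [List.length_cons, List.count_cons_self]
      congr 1
      ring
    · rw [mono_cons, ← mul_assoc, clE_mul_of_ne (Ne.symm h), neg_mul, mul_assoc, ih,
        mul_smul_comm, List.length_cons, List.count_cons_of_ne h, ← neg_smul, mul_assoc]
      congr 1
      ring

theorem mono_eq_of_mem {i : Fin n} {l : List (Fin n)} (h : i ∈ l) :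
    ∃ s : ℝ, mono l = s • (clE i * mono (l.erase i)) := by
  induction l with
  | nil => simp at h
  | cons j l ih =>
    by_cases hj : j = i
    · subst hj
      exact ⟨1, by simp⟩
    · obtain ⟨s, hs⟩ := ih ((List.mem_cons.1 h).resolve_left fun e => hj e.symm)
      refine ⟨-s, ?_⟩
      rw [mono_cons, hs, List.erase_cons_tail (by simpa using hj), mono_cons, mul_smul_comm,
        ← mul_assoc, clE_mul_of_ne hj, neg_mul, smul_neg, neg_smul, mul_assoc]

/-- Equal letters are brought together and cancel in pairs, since eᵢ² = 1. -/
theorem mono_of_count_even (l : List (Fin n)) (h : ∀ i, Even (l.count i)) :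
    ∃ s : ℝ, mono l = algebraMap ℝ (Cl n) s := by
  induction hk : l.length using Nat.strong_induction_on generalizing l with
  | _ k ih =>
    match l with
    | [] => exact ⟨1, by simp⟩
    | i :: l =>
      have hi : i ∈ l := by
        have := h i
        rw [List.count_cons_self] at this
        rw [← List.count_pos_iff]
        by_contra h0
        rw [Nat.eq_zero_of_not_pos h0] at this
        simp at this
      obtain ⟨s, hs⟩ := mono_eq_of_mem hi
      obtain ⟨t, ht⟩ := ih (l.erase i).length
        (by rw [← hk, List.length_cons]; have := List.length_erase_le (a := i) (l := l); omega)
        (l.erase i) (fun j => by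
          have hc := h j
          by_cases hj : j = i
          · subst hj
            have hpos := List.count_pos_iff.2 hi
            rw [List.count_cons_self] at hc
            rw [List.count_erase_self]
            obtain ⟨c, hc⟩ := hc
            exact ⟨c - 1, by omega⟩
          · rw [List.count_erase_of_ne hj]
            rwa [List.count_cons_of_ne (Ne.symm hj)] at hc) rfl
      refine ⟨s * t, ?_⟩
      rw [mono_cons, hs, mul_smul_comm, ← mul_assoc, clE_mul_self, one_mul, ht, map_mul,
        Algebra.smul_def]

theorem even_mem_span_mono {x : Cl n} (hx : x ∈ CliffordAlgebra.evenOdd (euclForm n) 0) :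
    x ∈ Submodule.span ℝ (mono '' {l : List (Fin n) | Even l.length}) := by
  induction x, hx using CliffordAlgebra.even_induction with
  | algebraMap r =>
    rw [Algebra.algebraMap_eq_smul_one]
    exact Submodule.smul_mem _ _ (Submodule.subset_span ⟨[], by simp, rfl⟩)
  | add _ _ _ _ hx hy => exact add_mem hx hy
  | ι_mul_ι_mul v w x _ hx =>
    rw [ι_eq_sum_clE, ι_eq_sum_clE, Finset.sum_mul_sum, Finset.sum_mul]
    refine sum_mem fun i _ => ?_
    rw [Finset.sum_mul]
    refine sum_mem fun j _ => ?_
    rw [smul_mul_smul_comm, smul_mul_assoc]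
    refine Submodule.smul_mem _ _ ?_
    clear * - hx
    induction hx using Submodule.span_induction with
    | mem y hy =>
      obtain ⟨l, hl, rfl⟩ := hy
      refine Submodule.subset_span ⟨i :: j :: l, ?_, by simp [mul_assoc]⟩
      simpa [Nat.even_add_one] using hl
    | zero => simp
    | add y z _ _ hy hz => rw [mul_add]; exact add_mem hy hz
    | smul c y _ hy => rw [mul_smul_comm]; exact Submodule.smul_mem _ _ hy

/-- The projection `x ↦ (x + eᵢ x eᵢ) / 2` onto the commutant of `eᵢ`. -/
def avg (i : Fin n) : Cl n →ₗ[ℝ] Cl n :=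
  (1 / 2 : ℝ) • (LinearMap.id + LinearMap.mulLeft ℝ (clE i) ∘ₗ LinearMap.mulRight ℝ (clE i))

theorem avg_apply (i : Fin n) (x : Cl n) :
    avg i x = (1 / 2 : ℝ) • (x + clE i * (x * clE i)) := rfl

/-- Conjugation by eᵢ multiplies a monomial by a sign, so the average keeps it or kills it. -/
theorem avg_mono (i : Fin n) (l : List (Fin n)) :
    avg i (mono l) = if Even (l.length + l.count i) then mono l else 0 := by
  rw [avg_apply, ← mul_assoc, clE_mul_mono, smul_mul_assoc, mul_assoc, clE_mul_self, mul_one]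
  split_ifs with h
  · rw [h.neg_one_pow, one_smul, ← two_smul ℝ, smul_smul]
    norm_num
  · rw [(Nat.not_even_iff_odd.1 h).neg_one_pow]
    simp

/-- The composition of the projections `avg i` over a list of indices. -/
def avgList (L : List (Fin n)) : Cl n →ₗ[ℝ] Cl n :=
  L.foldr (fun i Q => avg i ∘ₗ Q) LinearMap.id

theorem avgList_cons (i : Fin n) (L : List (Fin n)) : avgList (i :: L) = avg i ∘ₗ avgList L := rfl

theorem avgList_mono (L l : List (Fin n)) :
    avgList L (mono l) = if ∀ i ∈ L, Even (l.length + l.count i) then mono l else 0 := by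
  induction L with
  | nil => simp [avgList]
  | cons j L ih =>
    rw [avgList_cons, LinearMap.comp_apply, ih]
    by_cases h : ∀ i ∈ L, Even (l.length + l.count i)
    · rw [if_pos h, avg_mono]
      refine if_congr ?_ rfl rfl
      rw [List.forall_mem_cons, and_iff_left h]
    · rw [if_neg h, map_zero, if_neg]
      exact fun h' => h fun i hi => h' i (List.mem_cons_of_mem _ hi)

/-- The average over all basis vectors. -/
def avgAll (n : ℕ) : Cl n →ₗ[ℝ] Cl n := avgList (List.finRange n)

theorem avgAll_one : avgAll n 1 = 1 := by
  have := avgList_mono (List.finRange n) []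
  simpa [avgAll] using this

/-- In a surviving monomial every letter count has the parity of the length, which is even here, so
the monomial is a scalar. Evenness matters: for odd n the product e₁ ⋯ eₙ also survives the
averaging. -/
theorem avgAll_even {x : Cl n} (hx : x ∈ CliffordAlgebra.evenOdd (euclForm n) 0) :
    ∃ s : ℝ, avgAll n x = algebraMap ℝ (Cl n) s := by
  replace hx := even_mem_span_mono hx
  induction hx using Submodule.span_induction with
  | mem y hy =>
    obtain ⟨l, hl, rfl⟩ := hy
    rw [avgAll, avgList_mono]
    split_ifs with h
    · exact mono_of_count_even l fun i => (Nat.even_add.1 (h i (List.mem_finRange i))).1 hl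
    · exact ⟨0, by simp⟩
  | zero => exact ⟨0, by simp⟩
  | add y z _ _ hy hz =>
    obtain ⟨s, hs⟩ := hy
    obtain ⟨t, ht⟩ := hz
    exact ⟨s + t, by rw [map_add, hs, ht, map_add]⟩
  | smul c y _ hy =>
    obtain ⟨s, hs⟩ := hy
    exact ⟨c * s, by rw [map_smul, hs, map_mul, Algebra.smul_def]⟩

/-- The scalar part of an element of the Clifford algebra. -/
def scalarPart (n : ℕ) : Cl n →ₗ[ℝ] ℝ :=
  (ExteriorAlgebra.algebraMapInv (R := ℝ) (M := Fin n → ℝ)).toLinearMap ∘ₗ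
    (CliffordAlgebra.equivExterior (euclForm n)).toLinearMap

theorem scalarPart_algebraMap (s : ℝ) : scalarPart n (algebraMap ℝ (Cl n) s) = s := by
  simp only [scalarPart, LinearMap.comp_apply, LinearEquiv.coe_coe, AlgHom.toLinearMap_apply]
  rw [CliffordAlgebra.equivExterior, CliffordAlgebra.changeFormEquiv_apply,
    CliffordAlgebra.changeForm_algebraMap]
  exact ExteriorAlgebra.algebraMap_leftInverse (M := Fin n → ℝ) s

theorem vecPart_ι (v : Fin n → ℝ) : vecPart n (CliffordAlgebra.ι (euclForm n) v) = v := by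
  simp only [vecPart, LinearMap.comp_apply, LinearEquiv.coe_coe]
  rw [CliffordAlgebra.equivExterior, CliffordAlgebra.changeFormEquiv_apply,
    CliffordAlgebra.changeForm_ι]
  exact ExteriorAlgebra.ι_leftInverse v

/-! ### The vector representation -/

theorem conj_mem_range_ι (g : SpinG n) (v : Fin n → ℝ) :
    (g : Cl n) * CliffordAlgebra.ι (euclForm n) v * star (g : Cl n) ∈
      LinearMap.range (CliffordAlgebra.ι (euclForm n)) := by
  have := spinGroup.conjAct_smul_ι_mem_range_ι (x := spinGroup.toUnits g) g.2 v
  rwa [ConjAct.units_smul_def] at this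

theorem conj_clE (g : SpinG n) (i : Fin n) :
    (g : Cl n) * clE i * star (g : Cl n) =
      ∑ j, vecPart n ((g : Cl n) * clE i * star (g : Cl n)) j • clE j := by
  obtain ⟨w, hw⟩ := conj_mem_range_ι g (Pi.single i 1)
  rw [clE, ← hw, vecPart_ι, ι_eq_sum_clE]

/-- Intertwining form of the vector representation; it lets basis vectors move across g at the cost
of the functions u_ji. -/
theorem mul_clE (g : SpinG n) (i : Fin n) :
    (g : Cl n) * clE i =
      ∑ j, vecPart n ((g : Cl n) * clE i * star (g : Cl n)) j • (clE j * (g : Cl n)) := by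
  have := congrArg (· * (g : Cl n)) (conj_clE g i)
  simp only [mul_assoc, spinGroup.coe_star_mul_self, mul_one, Finset.sum_mul,
    smul_mul_assoc] at this
  simpa only [mul_assoc] using this

theorem vecRep_apply (j i : Fin n) (g : SpinG n) :
    (vecRep j i : Pol n).1 g = ((vecPart n ((g : Cl n) * clE i * star (g : Cl n)) j : ℝ) : ℂ) :=
  rfl

theorem ev_apply (g : SpinG n) (a : Pol n) : ev g a = a.1 g := rfl

theorem vecPart_clE (i j : Fin n) : vecPart n (clE i) j = if j = i then 1 else 0 := by
  rw [clE, vecPart_ι, Pi.single_apply]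

theorem counit_vecRep (j i : Fin n) :
    counit (vecRep j i : Pol n) = if j = i then 1 else 0 := by
  rw [ev_apply, vecRep_apply]
  simp only [OneMemClass.coe_one, one_mul, star_one, mul_one, vecPart_clE]
  split_ifs <;> simp

/-- Orthogonality of u_g: conjugation by g preserves the Clifford relations, hence the polar form.
-/
theorem sum_vecRep_mul_vecRep (a b : Fin n) :
    ∑ j, (vecRep j a : Pol n) * vecRep j b = if a = b then 1 else 0 := by
  refine Subtype.ext (funext fun g => ?_)
  obtain ⟨v, hv⟩ := conj_mem_range_ι g (Pi.single a 1)
  obtain ⟨w, hw⟩ := conj_mem_range_ι g (Pi.single b 1)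
  have hg := spinGroup.coe_star_mul_self g
  have key : CliffordAlgebra.ι (euclForm n) v * CliffordAlgebra.ι (euclForm n) w +
      CliffordAlgebra.ι (euclForm n) w * CliffordAlgebra.ι (euclForm n) v =
      algebraMap ℝ (Cl n) (if a = b then 2 else 0) := by
    rw [hv, hw]
    have h : ∀ x y : Cl n, (g : Cl n) * x * star (g : Cl n) * ((g : Cl n) * y * star (g : Cl n)) =
        (g : Cl n) * (x * y) * star (g : Cl n) := by
      intro x y
      rw [show (g : Cl n) * x * star (g : Cl n) * ((g : Cl n) * y * star (g : Cl n)) =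
        (g : Cl n) * x * (star (g : Cl n) * (g : Cl n)) * y * star (g : Cl n) by
          simp only [mul_assoc], hg, mul_one]
      simp only [mul_assoc]
    rw [h, h, ← add_mul, ← mul_add]
    have := clE_mul_add_swap a b
    rw [clE, clE] at this
    rw [this, ← Algebra.commutes, mul_assoc, spinGroup.mul_star_self_of_mem g.2, mul_one]
  rw [CliffordAlgebra.ι_mul_ι_add_swap] at key
  have key := congrArg (scalarPart n) key
  rw [scalarPart_algebraMap, scalarPart_algebraMap] at key
  have hsum : ∑ j, v j * w j = if a = b then 1 else 0 := by
    simp only [QuadraticMap.polar, QuadraticMap.weightedSumSquares_apply, Pi.add_apply, add_mul,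
      mul_add, Finset.sum_add_distrib, one_smul] at key
    have e : ∑ j, w j * v j = ∑ j, v j * w j := Finset.sum_congr rfl fun _ _ => mul_comm _ _
    rw [e] at key
    split_ifs at key ⊢ <;> linarith
  have e1 : (∑ j, (vecRep j a : Pol n) * vecRep j b).1 g = ((∑ j, v j * w j : ℝ) : ℂ) := by
    change ev g (∑ j, (vecRep j a : Pol n) * vecRep j b) = _
    rw [map_sum]
    push_cast
    refine Finset.sum_congr rfl fun j _ => ?_
    rw [map_mul, ev_apply, ev_apply, vecRep_apply, vecRep_apply, clE, clE, ← hv, ← hw, vecPart_ι,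
      vecPart_ι]
  rw [e1, hsum]
  split_ifs
  · simp
  · simp

end Clifford

/-! ### Point derivations of the algebra of polynomial functions -/

section PointDerivation

variable {n : ℕ}

/-- The restriction to `S(n)` of a linear functional on the Clifford algebra. -/
def linFun : (Cl n →ₗ[ℝ] ℂ) →ₗ[ℝ] Pol n where
  toFun φ := ⟨fun g => φ (g : Cl n), linear_mem_polyFun φ⟩
  map_add' _ _ := rfl
  map_smul' _ _ := rfl

theorem ev_linFun (g : SpinG n) (φ : Cl n →ₗ[ℝ] ℂ) : ev g (linFun φ) = φ (g : Cl n) := rfl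

theorem Pol_ext {a b : Pol n} (h : ∀ g, ev g a = ev g b) : a = b :=
  Subtype.ext (funext h)

/-- No star case is needed: the conjugate of a real-linear functional is again real-linear, so the
generating set is already closed under star. -/
theorem Pol_induction {p : Pol n → Prop} (lin : ∀ φ, p (linFun φ))
    (scalar : ∀ c : ℂ, p (algebraMap ℂ (Pol n) c)) (add : ∀ a b, p a → p b → p (a + b))
    (mul : ∀ a b, p a → p b → p (a * b)) (a : Pol n) : p a := by
  have ha : (a : SpinG n → ℂ) ∈ Algebra.adjoin ℂ
      ({f | ∃ φ : Cl n →ₗ[ℝ] ℂ, f = fun g : SpinG n => φ (g : Cl n)} ∪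
        star {f | ∃ φ : Cl n →ₗ[ℝ] ℂ, f = fun g : SpinG n => φ (g : Cl n)}) := a.2
  have hle : ∀ f ∈ Algebra.adjoin ℂ
      ({f | ∃ φ : Cl n →ₗ[ℝ] ℂ, f = fun g : SpinG n => φ (g : Cl n)} ∪
        star {f | ∃ φ : Cl n →ₗ[ℝ] ℂ, f = fun g : SpinG n => φ (g : Cl n)}),
      ∃ h : f ∈ polyFun n, p ⟨f, h⟩ := by
    intro f hf
    induction hf using Algebra.adjoin_induction with
    | mem f hf =>
      rcases hf with ⟨φ, rfl⟩ | ⟨φ, hφ⟩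
      · exact ⟨_, lin φ⟩
      · have hf : f = fun g : SpinG n => (Complex.conjLIE.toLinearMap ∘ₗ φ) (g : Cl n) := by
          rw [← star_star f, hφ]
          rfl
        subst hf
        exact ⟨_, lin (Complex.conjLIE.toLinearMap ∘ₗ φ)⟩
    | algebraMap c => exact ⟨_, scalar c⟩
    | add f h _ _ hf hh => exact ⟨_, add _ _ hf.2 hh.2⟩
    | mul f h _ _ hf hh => exact ⟨_, mul _ _ hf.2 hh.2⟩
  exact (hle _ ha).2

variable {M : Type*} [AddCommGroup M] [Module ℂ M]

/-- `D` is a derivation at the unit element of `S(n)`. -/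
def IsPointDerivation (D : Pol n →ₗ[ℂ] M) : Prop :=
  ∀ a b : Pol n, D (a * b) = counit a • D b + counit b • D a

namespace IsPointDerivation

variable {D : Pol n →ₗ[ℂ] M}

theorem map_one (hD : IsPointDerivation D) : D 1 = 0 := by
  have := hD 1 1
  rw [mul_one, _root_.map_one (counit (n := n)), one_smul] at this
  exact left_eq_add.1 this

theorem map_algebraMap (hD : IsPointDerivation D) (c : ℂ) : D (algebraMap ℂ (Pol n) c) = 0 := by
  rw [Algebra.algebraMap_eq_smul_one, map_smul, hD.map_one, smul_zero]

/-- On the group φ(e_k g e_k) = ∑ⱼ u_jk(g) φ(e_k eⱼ g). A derivation killing the u_jk sees only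
their values δ_jk at the unit, and e_k e_k = 1 leaves φ(g). -/
theorem map_linFun_conj (hD : IsPointDerivation D) (h0 : ∀ j i, D (vecRep j i) = 0)
    (φ : Cl n →ₗ[ℝ] ℂ) (k : Fin n) :
    D (linFun (φ ∘ₗ LinearMap.mulLeft ℝ (clE k) ∘ₗ LinearMap.mulRight ℝ (clE k))) =
      D (linFun φ) := by
  have e : linFun (φ ∘ₗ LinearMap.mulLeft ℝ (clE k) ∘ₗ LinearMap.mulRight ℝ (clE k)) =
      ∑ j, vecRep j k * linFun (φ ∘ₗ LinearMap.mulLeft ℝ (clE k * clE j)) := by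
    refine Pol_ext fun g => ?_
    rw [map_sum, ev_linFun]
    simp only [LinearMap.comp_apply, LinearMap.mulLeft_apply, LinearMap.mulRight_apply, map_mul,
      ev_linFun]
    rw [mul_clE, Finset.mul_sum, map_sum]
    refine Finset.sum_congr rfl fun j _ => ?_
    rw [mul_smul_comm, map_smul, Complex.real_smul, ev_apply, vecRep_apply, ← mul_assoc (clE k)]
  rw [e, map_sum, Finset.sum_eq_single k]
  · rw [hD, h0, smul_zero, add_zero, counit_vecRep, if_pos rfl, one_smul, clE_mul_self]
    congr 2
    ext x
    simp
  · intro j _ hj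
    rw [hD, h0, smul_zero, add_zero, counit_vecRep, if_neg hj, zero_smul]
  · simp

theorem map_linFun_avg (hD : IsPointDerivation D) (h0 : ∀ j i, D (vecRep j i) = 0)
    (φ : Cl n →ₗ[ℝ] ℂ) (k : Fin n) : D (linFun (φ ∘ₗ avg k)) = D (linFun φ) := by
  have e : linFun (φ ∘ₗ avg k) = (1 / 2 : ℂ) • (linFun φ +
      linFun (φ ∘ₗ LinearMap.mulLeft ℝ (clE k) ∘ₗ LinearMap.mulRight ℝ (clE k))) := by
    refine Pol_ext fun g => ?_
    rw [map_smul, map_add, ev_linFun, ev_linFun, ev_linFun]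
    simp only [LinearMap.comp_apply, LinearMap.mulLeft_apply, LinearMap.mulRight_apply, avg_apply,
      map_smul, map_add, Complex.real_smul, smul_eq_mul]
    norm_num
  rw [e, map_smul, map_add, hD.map_linFun_conj h0, ← two_smul ℂ, smul_smul]
  norm_num

theorem map_linFun_avgAll (hD : IsPointDerivation D) (h0 : ∀ j i, D (vecRep j i) = 0)
    (φ : Cl n →ₗ[ℝ] ℂ) : D (linFun (φ ∘ₗ avgAll n)) = D (linFun φ) := by
  rw [avgAll]
  induction List.finRange n generalizing φ with
  | nil => rfl
  | cons i L ih =>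
    rw [avgList_cons, ← LinearMap.comp_assoc, ih, hD.map_linFun_avg h0]

/-- Infinitesimal form of the fact that the kernel of the spin group acting on vectors is discrete.
Averaging reduces all linear functions to multiples of one function τ, and the relation g g* = 1
kills `D` on τ. -/
theorem eq_zero (hD : IsPointDerivation D) (h0 : ∀ j i, D (vecRep j i) = 0) : D = 0 := by
  let τ : Cl n →ₗ[ℝ] ℂ := Complex.ofRealLI.toLinearMap ∘ₗ scalarPart n ∘ₗ avgAll n
  have hτ1 : τ 1 = 1 := by
    change ((scalarPart n (avgAll n 1) : ℝ) : ℂ) = 1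
    rw [avgAll_one, ← _root_.map_one (algebraMap ℝ (Cl n)), scalarPart_algebraMap,
      Complex.ofReal_one]
  -- `D` does not notice the averaging, and an averaged group element is a scalar, so φ becomes φ(1)
  -- τ on the group.
  have hlin : ∀ φ : Cl n →ₗ[ℝ] ℂ, D (linFun φ) = φ 1 • D (linFun τ) := by
    intro φ
    rw [← hD.map_linFun_avgAll h0 φ, ← map_smul]
    congr 1
    refine Pol_ext fun g => ?_
    rw [map_smul, ev_linFun, ev_linFun, smul_eq_mul]
    obtain ⟨s, hs⟩ := avgAll_even (spinGroup.mem_even g.2)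
    change φ (avgAll n g) = φ 1 * ((scalarPart n (avgAll n g) : ℝ) : ℂ)
    rw [hs, scalarPart_algebraMap, Algebra.algebraMap_eq_smul_one, map_smul, Complex.real_smul,
      mul_comm]
  -- Expand τ(g g*) = 1 as a quadratic relation between coordinate functions. Applying `D` gives 2
  -- τ(1) D(τ) = 0, and τ(1) = 1.
  have hτ : D (linFun τ) = 0 := by
    let b := Module.finBasis ℝ (Cl n)
    let c : Fin (Module.finrank ℝ (Cl n)) → (Cl n →ₗ[ℝ] ℂ) :=
      fun p => Complex.ofRealLI.toLinearMap ∘ₗ b.coord p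
    have hexp : ∀ x : Cl n, τ (x * star x) =
        ∑ p, ∑ q, τ (b p * star (b q)) * (c p x * c q x) := by
      intro x
      conv_lhs => rw [← b.sum_repr x]
      rw [star_sum, Finset.sum_mul_sum, map_sum]
      refine Finset.sum_congr rfl fun p _ => ?_
      rw [map_sum]
      refine Finset.sum_congr rfl fun q _ => ?_
      rw [CliffordAlgebra.star_smul, smul_mul_smul_comm, map_smul, Complex.real_smul]
      change _ = _ * (((b.repr x p : ℝ) : ℂ) * ((b.repr x q : ℝ) : ℂ))
      push_cast
      ring
    have hone : ∑ p, ∑ q, τ (b p * star (b q)) • (linFun (c p) * linFun (c q)) =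
        (1 : Pol n) := by
      refine Pol_ext fun g => ?_
      simp only [map_sum, map_smul, map_mul, ev_linFun, smul_eq_mul]
      rw [← hexp, spinGroup.mul_star_self_of_mem g.2, hτ1, _root_.map_one]
    have h := congrArg D hone
    rw [hD.map_one] at h
    simp only [map_sum, map_smul, hD (linFun _) (linFun _)] at h
    have h2 : ∀ p q, τ (b p * star (b q)) • (counit (linFun (c p)) • D (linFun (c q)) +
        counit (linFun (c q)) • D (linFun (c p))) =
        (2 * (τ (b p * star (b q)) * (c p 1 * c q 1))) • D (linFun τ) := by
      intro p q
      rw [hlin (c q), hlin (c p), ev_linFun, ev_linFun, smul_smul, smul_smul, ← add_smul,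
        smul_smul]
      congr 1
      simp only [OneMemClass.coe_one]
      ring
    simp only [h2] at h
    simp only [← Finset.sum_smul, ← Finset.mul_sum] at h
    rw [← hexp, star_one, mul_one, hτ1, mul_one] at h
    exact (smul_eq_zero.1 h).resolve_left two_ne_zero
  refine LinearMap.ext fun a => ?_
  induction a using Pol_induction with
  | lin φ => rw [hlin, hτ, smul_zero, LinearMap.zero_apply]
  | scalar c => rw [hD.map_algebraMap, LinearMap.zero_apply]
  | add a b ha hb => rw [map_add, ha, hb, map_add]
  | mul a b ha hb => simp [hD a b, ha, hb]

/-- Differentiate the orthogonality relation at the unit. -/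
theorem antisymm (hD : IsPointDerivation D) (a b : Fin n) :
    D (vecRep b a) = - D (vecRep a b) := by
  have h := congrArg D (sum_vecRep_mul_vecRep a b)
  have h1 : D (if a = b then 1 else 0) = 0 := by
    split_ifs
    · exact hD.map_one
    · exact map_zero D
  rw [h1, map_sum] at h
  simp only [hD (vecRep _ _) (vecRep _ _), counit_vecRep, ite_smul, one_smul, zero_smul,
    Finset.sum_add_distrib, Finset.sum_ite_eq', Finset.mem_univ, if_true] at h
  rw [add_comm] at h
  exact eq_neg_of_add_eq_zero_left h

end IsPointDerivation

/-! ### The generators `e_kl` -/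

theorem rot_coe {k l : Fin n} (h : k ≠ l) (t : ℝ) : (rot k l t : Cl n) =
    algebraMap ℝ (Cl n) (Real.cos (t / 2)) + Real.sin (t / 2) • (clE k * clE l) := by
  rw [rot, dif_neg h]

theorem rot_zero (k l : Fin n) : rot k l 0 = 1 := by
  by_cases h : k = l
  · rw [rot, dif_pos h]
  · refine Subtype.ext ?_
    rw [rot_coe h]
    simp

theorem hasDerivAt_linFun_rot {k l : Fin n} (h : k ≠ l) (φ : Cl n →ₗ[ℝ] ℂ) :
    HasDerivAt (fun t : ℝ => ev (rot k l t) (linFun φ)) (φ ((1 / 2 : ℝ) • (clE k * clE l))) 0 := by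
  have e : (fun t : ℝ => ev (rot k l t) (linFun φ)) = fun t : ℝ =>
      Real.cos (t / 2) • φ 1 + Real.sin (t / 2) • φ (clE k * clE l) := by
    funext t
    rw [ev_linFun, rot_coe h, map_add, map_smul, Algebra.algebraMap_eq_smul_one, map_smul]
  rw [e]
  have hc : HasDerivAt (fun t : ℝ => Real.cos (t / 2)) (-Real.sin (0 / 2) * (1 / 2)) 0 :=
    (Real.hasDerivAt_cos _).comp (0 : ℝ) ((hasDerivAt_id (0 : ℝ)).div_const 2)
  have hs : HasDerivAt (fun t : ℝ => Real.sin (t / 2)) (Real.cos (0 / 2) * (1 / 2)) 0 :=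
    (Real.hasDerivAt_sin _).comp (0 : ℝ) ((hasDerivAt_id (0 : ℝ)).div_const 2)
  refine ((hc.smul_const (φ 1)).add (hs.smul_const (φ (clE k * clE l)))).congr_deriv ?_
  rw [map_smul, zero_div, Real.sin_zero, Real.cos_zero, neg_zero, zero_mul, zero_smul, zero_add,
    one_mul]

theorem genPi_self (k : Fin n) (a : Pol n) : genPi k k a = 0 := by
  simp [genPi, rot]

theorem genPi_linFun {k l : Fin n} (h : k ≠ l) (φ : Cl n →ₗ[ℝ] ℂ) :
    genPi k l (linFun φ) = φ ((1 / 2 : ℝ) • (clE k * clE l)) :=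
  (hasDerivAt_linFun_rot h φ).deriv

/-- `deriv` is zero by default, so additivity and the Leibniz rule for `genPi` require actual
differentiability. -/
theorem differentiableAt_ev_rot (k l : Fin n) (a : Pol n) :
    DifferentiableAt ℝ (fun t : ℝ => ev (rot k l t) a) 0 := by
  by_cases h : k = l
  · subst h
    simp [rot]
  induction a using Pol_induction with
  | lin φ => exact (hasDerivAt_linFun_rot h φ).differentiableAt
  | scalar c => simp
  | add a b ha hb => simp only [map_add]; exact ha.add hb
  | mul a b ha hb => simp only [map_mul]; exact ha.mul hb

/-- The derivative at the unit along `e_kl`, as a linear functional. -/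
def genLin (k l : Fin n) : Pol n →ₗ[ℂ] ℂ where
  toFun := genPi k l
  map_add' a b := by
    simp only [genPi, map_add]
    exact deriv_add (differentiableAt_ev_rot k l a) (differentiableAt_ev_rot k l b)
  map_smul' c a := by
    simp only [genPi, map_smul, smul_eq_mul, RingHom.id_apply]
    exact deriv_const_mul c (differentiableAt_ev_rot k l a)

theorem genLin_apply (k l : Fin n) (a : Pol n) : genLin k l a = genPi k l a := rfl

theorem genLin_isPointDerivation (k l : Fin n) : IsPointDerivation (genLin k l) := by
  intro a b
  simp only [genLin_apply, genPi, map_mul, smul_eq_mul]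
  rw [deriv_fun_mul (differentiableAt_ev_rot k l a) (differentiableAt_ev_rot k l b), rot_zero]
  ring

/-- This is the matrix of E_kl - E_lk: the generator e_k e_l / 2 acts on vectors by commutator, and
[e_k e_l, e_b] = 2δ_lb e_k - 2δ_kb e_l. -/
theorem genPi_vecRep (k l a b : Fin n) :
    genPi k l (vecRep a b : Pol n) =
      (if a = k then 1 else 0) * (if l = b then 1 else 0) -
        (if a = l then 1 else 0) * (if k = b then 1 else 0) := by
  by_cases h : k = l
  · subst h
    rw [genPi_self, sub_self]
  have hlk : l ≠ k := Ne.symm h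
  -- g e_b g* is quadratic in cos(t/2) and sin(t/2). At t = 0 the cos² and sin² terms have zero
  -- derivative, and the mixed term has derivative 1/2.
  have key : (fun t : ℝ => ev (rot k l t) (vecRep a b : Pol n)) = fun t : ℝ =>
      ((Real.cos (t / 2) ^ 2 * (if a = b then 1 else 0) +
        Real.sin (t / 2) * Real.cos (t / 2) *
          (vecPart n (clE k * clE l * clE b - clE b * (clE k * clE l)) a) -
        Real.sin (t / 2) ^ 2 *
          (vecPart n (clE k * clE l * clE b * (clE k * clE l)) a) : ℝ) : ℂ) := by
    funext t
    rw [ev_apply, vecRep_apply]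
    congr 1
    have hst : star (rot k l t : Cl n) = algebraMap ℝ (Cl n) (Real.cos (t / 2)) -
        Real.sin (t / 2) • (clE k * clE l) := by
      rw [rot_coe h, star_add, CliffordAlgebra.star_algebraMap, CliffordAlgebra.star_smul,
        star_mul, clE, clE, CliffordAlgebra.star_ι, CliffordAlgebra.star_ι, neg_mul_neg]
      have := clE_mul_of_ne hlk
      rw [clE, clE] at this
      rw [this, smul_neg, sub_eq_add_neg]
    rw [hst, rot_coe h]
    set c := Real.cos (t / 2)
    set s := Real.sin (t / 2)
    have : (algebraMap ℝ (Cl n) c + s • (clE k * clE l)) * clE b *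
        (algebraMap ℝ (Cl n) c - s • (clE k * clE l)) =
        (c ^ 2) • clE b + (s * c) • (clE k * clE l * clE b - clE b * (clE k * clE l)) -
          (s ^ 2) • (clE k * clE l * clE b * (clE k * clE l)) := by
      simp only [Algebra.algebraMap_eq_smul_one, add_mul, mul_sub, smul_mul_assoc, mul_smul_comm,
        one_mul, mul_one, smul_add, smul_sub, smul_smul]
      module
    rw [this]
    simp only [map_add, map_sub, map_smul, Pi.add_apply, Pi.sub_apply, Pi.smul_apply, smul_eq_mul,
      vecPart_clE]
  have hcomm : clE k * clE l * clE b - clE b * (clE k * clE l) =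
      (if l = b then (2 : ℝ) else 0) • clE k - (if k = b then (2 : ℝ) else 0) • clE l := by
    have h1 := clE_mul_add_swap l b
    have h2 := clE_mul_add_swap k b
    rw [Algebra.algebraMap_eq_smul_one] at h1 h2
    have h1' := congrArg (clE k * ·) h1
    have h2' := congrArg (· * clE l) h2
    simp only [mul_add, add_mul, mul_smul_comm, smul_mul_assoc, mul_one, one_mul] at h1' h2'
    rw [← h1', ← h2']
    simp only [mul_assoc]
    abel
  set u := vecPart n (clE k * clE l * clE b - clE b * (clE k * clE l)) a with hu
  set v := vecPart n (clE k * clE l * clE b * (clE k * clE l)) a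
  have hc : HasDerivAt (fun t : ℝ => Real.cos (t / 2)) (-Real.sin (0 / 2) * (1 / 2)) 0 :=
    (Real.hasDerivAt_cos _).comp (0 : ℝ) ((hasDerivAt_id (0 : ℝ)).div_const 2)
  have hs : HasDerivAt (fun t : ℝ => Real.sin (t / 2)) (Real.cos (0 / 2) * (1 / 2)) 0 :=
    (Real.hasDerivAt_sin _).comp (0 : ℝ) ((hasDerivAt_id (0 : ℝ)).div_const 2)
  have hd := ((((hc.fun_pow 2).mul_const (if a = b then (1 : ℝ) else 0)).add
    ((hs.mul hc).mul_const u)).sub ((hs.fun_pow 2).mul_const v)).ofReal_comp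
  rw [genPi, key]
  refine hd.deriv.trans ?_
  rw [hcomm, map_sub, map_smul, map_smul, Pi.sub_apply, Pi.smul_apply, Pi.smul_apply, vecPart_clE,
    vecPart_clE] at hu
  rw [hu]
  simp only [zero_div, Real.sin_zero, Real.cos_zero, smul_eq_mul]
  push_cast
  split_ifs <;> norm_num

/-- A point derivation is a combination of the generators `e_kl`. -/
theorem IsPointDerivation.eq_sum_genPi {M : Type*} [AddCommGroup M] [Module ℂ M]
    {D : Pol n →ₗ[ℂ] M} (hD : IsPointDerivation D) (a : Pol n) :
    D a = (1 / 2 : ℂ) • ∑ k, ∑ l, genPi k l a • D (vecRep k l) := by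
  let D' : Pol n →ₗ[ℂ] M :=
    D - (1 / 2 : ℂ) • ∑ k, ∑ l, (genLin k l).smulRight (D (vecRep k l))
  have happ : ∀ a, D' a = D a - (1 / 2 : ℂ) • ∑ k, ∑ l, genPi k l a • D (vecRep k l) := by
    intro a
    simp [D', LinearMap.sum_apply, genLin_apply]
  have hD' : IsPointDerivation D' := by
    intro a b
    have hg : ∀ k l : Fin n, genPi k l (a * b) • D (vecRep k l) =
        counit a • (genPi k l b • D (vecRep k l)) + counit b • (genPi k l a • D (vecRep k l)) := by
      intro k l
      have := genLin_isPointDerivation k l a b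
      rw [genLin_apply, genLin_apply, genLin_apply] at this
      rw [this, add_smul, smul_assoc, smul_assoc]
    rw [happ, happ, happ, hD a b]
    simp only [hg, Finset.sum_add_distrib, ← Finset.smul_sum]
    module
  have h0 : D' = 0 := by
    -- It suffices to compare on the u_ji. There the double sum gives D(u_ji) - D(u_ij) = 2 D(u_ji),
    -- which the factor 1/2 compensates.
    refine hD'.eq_zero fun j i => ?_
    rw [happ, sub_eq_zero]
    simp only [genPi_vecRep, sub_smul, Finset.sum_sub_distrib, mul_ite, mul_one, mul_zero,
      ite_smul, one_smul, zero_smul, Finset.sum_ite_eq, Finset.sum_ite_eq',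
      Finset.mem_univ, if_true]
    simp [hD.antisymm j i]
    module
  have := happ a
  rw [h0, LinearMap.zero_apply] at this
  exact (sub_eq_zero.1 this.symm)

end PointDerivation

/-! ### Infinitesimal spin representation -/

section Spin

variable {r : ℕ}

theorem genPi_spinRep {k l : Fin (2 * r)} (h : k ≠ l) (J I : Finset (Fin r)) :
    genPi k l (spinRep J I) = (1 / 2 : ℂ) * (sig r).coord J (gam k (gam l (sig r I))) := by
  have := genPi_linFun h
    { toFun := fun x : Cl (2 * r) => (sig r).coord J (cliffAct r x (sig r I))
      map_add' := by intro x y; simp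
      map_smul' := by intro c x; simp }
  refine this.trans ?_
  simp [gam]

end Spin

/-! ### Components of the curvature -/

section Curvature

variable {n : ℕ} {B : Type*} [Ring B] [Algebra ℂ B]

theorem slice_tmul {M : Type*} [AddCommGroup M] [Module ℂ M] (f : M →ₗ[ℂ] ℂ) (b : B) (m : M) :
    slice f (b ⊗ₜ[ℂ] m) = f m • b := by
  simp [slice]

theorem slice_left_mul {A : Type*} [Ring A] [Algebra ℂ A] (f : A →ₗ[ℂ] ℂ) (b : B)
    (x : B ⊗[ℂ] A) : slice f ((b ⊗ₜ[ℂ] (1 : A)) * x) = b * slice f x := by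
  induction x using TensorProduct.induction_on with
  | zero => simp
  | tmul c a =>
    rw [Algebra.TensorProduct.tmul_mul_tmul, one_mul, slice_tmul, slice_tmul, mul_smul_comm]
  | add x y hx hy => rw [mul_add, map_add, hx, hy, map_add, mul_add]

/-- The map `b ⊗ a ↦ b z D(a)`. -/
def mulMid {A : Type*} [AddCommGroup A] [Module ℂ A] (D : A →ₗ[ℂ] B) (z : B) : B ⊗[ℂ] A →ₗ[ℂ] B :=
  LinearMap.mul' ℂ B ∘ₗ TensorProduct.map (LinearMap.mulRight ℂ z) D

/-- The map `b ⊗ a ↦ b D(a)`. -/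
def mulComp {A : Type*} [AddCommGroup A] [Module ℂ A] (D : A →ₗ[ℂ] B) : B ⊗[ℂ] A →ₗ[ℂ] B :=
  LinearMap.mul' ℂ B ∘ₗ LinearMap.lTensor B D

theorem mulMid_tmul {A : Type*} [AddCommGroup A] [Module ℂ A] (D : A →ₗ[ℂ] B) (z b : B) (a : A) :
    mulMid D z (b ⊗ₜ[ℂ] a) = b * z * D a := by
  simp [mulMid]

theorem mulComp_tmul {A : Type*} [AddCommGroup A] [Module ℂ A] (D : A →ₗ[ℂ] B) (b : B) (a : A) :
    mulComp D (b ⊗ₜ[ℂ] a) = b * D a := by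
  simp [mulComp]

theorem mulMid_left_mul {A : Type*} [Ring A] [Algebra ℂ A] (D : A →ₗ[ℂ] B) (z q : B)
    (x : B ⊗[ℂ] A) : mulMid D z ((q ⊗ₜ[ℂ] (1 : A)) * x) = q * mulMid D z x := by
  induction x using TensorProduct.induction_on with
  | zero => simp
  | tmul c a =>
    rw [Algebra.TensorProduct.tmul_mul_tmul, one_mul, mulMid_tmul, mulMid_tmul]
    simp only [mul_assoc]
  | add x y hx hy => rw [mul_add, map_add, hx, hy, map_add, mul_add]

theorem mulComp_left_mul {A : Type*} [Ring A] [Algebra ℂ A] (D : A →ₗ[ℂ] B) (q : B)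
    (x : B ⊗[ℂ] A) : mulComp D ((q ⊗ₜ[ℂ] (1 : A)) * x) = q * mulComp D x := by
  induction x using TensorProduct.induction_on with
  | zero => simp
  | tmul c a =>
    rw [Algebra.TensorProduct.tmul_mul_tmul, one_mul, mulComp_tmul, mulComp_tmul, mul_assoc]
  | add x y hx hy => rw [mul_add, map_add, hx, hy, map_add, mul_add]

/-- Leibniz rule in `B ⊗ Pol n`. As `B` is noncommutative, the coefficient of y stays between the
coefficient of x and the value of `D`; this is why `mulMid` is needed. -/
theorem IsPointDerivation.mulComp_mul {D : Pol n →ₗ[ℂ] B} (hD : IsPointDerivation D)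
    (x y : B ⊗[ℂ] Pol n) :
    mulComp D (x * y) = slice (counit (n := n)).toLinearMap x * mulComp D y +
      mulMid D (slice (counit (n := n)).toLinearMap y) x := by
  induction x using TensorProduct.induction_on with
  | zero => simp
  | add x x' hx hx' =>
    rw [add_mul, map_add, hx, hx', map_add, map_add, add_mul]
    abel
  | tmul b a =>
    induction y using TensorProduct.induction_on with
    | zero => simp [mulMid]
    | add y y' hy hy' =>
      rw [mul_add, map_add, hy, hy', map_add, map_add, mulMid_tmul, mulMid_tmul, mulMid_tmul,
        mul_add, mul_add, add_mul]
      abel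
    | tmul b' a' =>
      rw [Algebra.TensorProduct.tmul_mul_tmul, mulComp_tmul, mulComp_tmul, slice_tmul, slice_tmul,
        mulMid_tmul, hD a a']
      simp only [AlgHom.toLinearMap_apply, mul_add, mul_smul_comm, smul_mul_assoc, mul_assoc]

theorem mulBy_tmul (ϱ : Pol n →ₗ[ℂ] Hor n B) (b : B) (a : Pol n) :
    mulBy ϱ (b ⊗ₜ[ℂ] a) = (b ⊗ₜ[ℂ] (1 : Ext n)) * ϱ a := by
  simp [mulBy]

theorem mulBy_left_mul (ϱ : Pol n →ₗ[ℂ] Hor n B) (q : B) (x : B ⊗[ℂ] Pol n) :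
    mulBy ϱ ((q ⊗ₜ[ℂ] (1 : Pol n)) * x) = (q ⊗ₜ[ℂ] (1 : Ext n)) * mulBy ϱ x := by
  induction x using TensorProduct.induction_on with
  | zero => simp
  | tmul c a =>
    rw [Algebra.TensorProduct.tmul_mul_tmul, one_mul, mulBy_tmul, mulBy_tmul, ← mul_assoc,
      Algebra.TensorProduct.tmul_mul_tmul, one_mul]
  | add x y hx hy => rw [mul_add, map_add, hx, hy, map_add, mul_add]

theorem slice_mulBy (ϱ : Pol n →ₗ[ℂ] Hor n B) (i j : Fin n) (x : B ⊗[ℂ] Pol n) :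
    slice (coeff₂ i j) (mulBy ϱ x) = mulComp (curvComp ϱ i j) x := by
  induction x using TensorProduct.induction_on with
  | zero => simp
  | tmul b a => rw [mulBy_tmul, slice_left_mul, mulComp_tmul]; rfl
  | add x y hx hy => rw [map_add, map_add, hx, hy, map_add]

theorem coeff₂_swap (i j : Fin n) : coeff₂ j i = - coeff₂ i j := by
  refine LinearMap.ext fun ω => ?_
  simp only [coeff₂, LinearMap.comp_apply, LinearMap.neg_apply]
  rw [CliffordAlgebra.contractLeft_comm, map_neg]

theorem coeff₂_extE_mul_extE (i j k l : Fin n) :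
    coeff₂ i j (extE k * extE l) =
      (if k = i then 1 else 0) * (if l = j then 1 else 0) -
        (if l = i then 1 else 0) * (if k = j then 1 else 0) := by
  have h1 : CliffordAlgebra.contractLeft (LinearMap.proj (R := ℂ) (φ := fun _ : Fin n => ℂ) i)
      (extE k * extE l) = (if k = i then (1 : ℂ) else 0) • extE l -
        (if l = i then (1 : ℂ) else 0) • extE k := by
    rw [extE, extE]
    erw [CliffordAlgebra.contractLeft_ι_mul, CliffordAlgebra.contractLeft_ι]
    rw [LinearMap.proj_apply, LinearMap.proj_apply, Pi.single_apply, Pi.single_apply,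
      ← Algebra.commutes, ← Algebra.smul_def]
    simp only [eq_comm]
  have h2 : ∀ m : Fin n, ExteriorAlgebra.algebraMapInv (R := ℂ)
      (CliffordAlgebra.contractLeft (LinearMap.proj (R := ℂ) (φ := fun _ : Fin n => ℂ) j)
      (extE m)) = if m = j then 1 else 0 := by
    intro m
    rw [extE]
    erw [CliffordAlgebra.contractLeft_ι]
    rw [LinearMap.proj_apply, Pi.single_apply]
    refine (ExteriorAlgebra.algebraMap_leftInverse (M := Fin n → ℂ) _).trans ?_
    simp only [eq_comm]
  simp only [coeff₂, LinearMap.comp_apply, AlgHom.toLinearMap_apply]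
  rw [h1, map_sub, map_sub, map_smul, map_smul, map_smul, map_smul, h2, h2, smul_eq_mul,
    smul_eq_mul]

theorem curvComp_swap (ϱ : Pol n →ₗ[ℂ] Hor n B) (i j : Fin n) :
    curvComp ϱ j i = - curvComp ϱ i j := by
  rw [curvComp, curvComp, coeff₂_swap i j]
  simp [slice, LinearMap.lTensor_neg]

theorem curvComp_isPointDerivation {ϱ : Pol n →ₗ[ℂ] Hor n B} (hcl : IsClassical ϱ) (i j : Fin n) :
    IsPointDerivation (curvComp ϱ i j) := by
  intro a b
  simp only [curvComp, LinearMap.comp_apply, hcl a b, map_add, map_smul]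

theorem nabla_tmul (X : Fin n → B →ₗ[ℂ] B) (b : B) (ω : Ext n) :
    nabla X (b ⊗ₜ[ℂ] ω) = ∑ k, X k b ⊗ₜ[ℂ] (extE k * ω) := by
  simp [nabla]

theorem nabla_nabla (X : Fin n → B →ₗ[ℂ] B) (b : B) :
    nabla X (nabla X (b ⊗ₜ[ℂ] 1)) = ∑ l, ∑ k, X k (X l b) ⊗ₜ[ℂ] (extE k * extE l) := by
  simp only [nabla_tmul, map_sum, mul_one]

/-- The `2`-form component of a horizontal form. -/
def twoFormPart (n : ℕ) (B : Type*) [Ring B] [Algebra ℂ B] : Hor n B →ₗ[ℂ] Hor n B :=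
  (1 / 2 : ℂ) • ∑ i : Fin n, ∑ j : Fin n,
    (TensorProduct.mk ℂ B (Ext n)).flip (extE i * extE j) ∘ₗ slice (coeff₂ i j)

theorem twoFormPart_apply (ω : Hor n B) :
    twoFormPart n B ω = (1 / 2 : ℂ) • ∑ i, ∑ j,
      slice (coeff₂ i j) ω ⊗ₜ[ℂ] (extE i * extE j) := by
  simp [twoFormPart, LinearMap.sum_apply]

theorem extE_mul_swap (k l : Fin n) : extE l * extE k = -(extE k * extE l) :=
  eq_neg_of_add_eq_zero_left (ExteriorAlgebra.ι_add_mul_swap _ _)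

theorem twoFormPart_tmul (b : B) (k l : Fin n) :
    twoFormPart n B (b ⊗ₜ[ℂ] (extE k * extE l)) = b ⊗ₜ[ℂ] (extE k * extE l) := by
  rw [twoFormPart_apply]
  simp only [slice_tmul, coeff₂_extE_mul_extE, sub_smul, TensorProduct.sub_tmul,
    Finset.sum_sub_distrib, mul_ite, mul_one, mul_zero, ite_smul, one_smul, zero_smul]
  have h1 : ∑ i : Fin n, ∑ j : Fin n, (if l = j then if k = i then b else 0 else 0) ⊗ₜ[ℂ]
      (extE i * extE j) = b ⊗ₜ[ℂ] (extE k * extE l) := by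
    rw [Finset.sum_eq_single k, Finset.sum_eq_single l]
    · simp
    · intro j _ hj
      simp [Ne.symm hj]
    · simp
    · intro i _ hi
      simp [Ne.symm hi]
    · simp
  have h2 : ∑ i : Fin n, ∑ j : Fin n, (if k = j then if l = i then b else 0 else 0) ⊗ₜ[ℂ]
      (extE i * extE j) = -(b ⊗ₜ[ℂ] (extE k * extE l)) := by
    rw [Finset.sum_eq_single l, Finset.sum_eq_single k]
    · simp [extE_mul_swap k l, TensorProduct.tmul_neg]
    · intro j _ hj
      simp [Ne.symm hj]
    · simp
    · intro i _ hi
      simp [Ne.symm hi]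
    · simp
  rw [h1, h2, sub_neg_eq_add, ← two_smul ℂ, smul_smul]
  norm_num

theorem twoFormPart_left_mul (q : B) (ω : Hor n B) :
    twoFormPart n B ((q ⊗ₜ[ℂ] (1 : Ext n)) * ω) =
      (q ⊗ₜ[ℂ] (1 : Ext n)) * twoFormPart n B ω := by
  simp only [twoFormPart_apply, mul_smul_comm, Finset.mul_sum, slice_left_mul,
    Algebra.TensorProduct.tmul_mul_tmul, one_mul]

variable [StarRing B] [StarModule ℂ B] {P : SpinBundle n B}

variable {X : Fin n → B →ₗ[ℂ] B} {ϱ : Pol n →ₗ[ℂ] Hor n B}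

/-- Both sides are the coefficient of eᵢ ∧ eⱼ in ∇²(b). -/
theorem IsCurvature.commutator (hϱ : IsCurvature P X ϱ) (i j : Fin n) (b : B) :
    X i (X j b) - X j (X i b) = - mulComp (curvComp ϱ i j) (P.F b) := by
  rw [← slice_mulBy, ← map_neg, ← hϱ b, nabla_nabla]
  simp only [map_sum, slice_tmul, coeff₂_extE_mul_extE, sub_smul, Finset.sum_sub_distrib, mul_ite,
    mul_one, mul_zero, ite_smul, one_smul, zero_smul]
  simp

/-- Freeness writes 1 ⊗ a as ∑ q F(b), so ϱ(a) = -∑ q ∇²(b), and ∇² of a function is visibly a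
2-form. -/
theorem IsCurvature.eq_twoForm (hϱ : IsCurvature P X ϱ) (a : Pol n) :
    ϱ a = (1 / 2 : ℂ) • ∑ i, ∑ j, curvComp ϱ i j a ⊗ₜ[ℂ] (extE i * extE j) := by
  suffices h : twoFormPart n B (ϱ a) = ϱ a by
    exact h.symm.trans (twoFormPart_apply _)
  obtain ⟨m, q, b, h⟩ := P.free a
  have h' := congrArg (mulBy ϱ) h
  rw [mulBy_tmul, ← Algebra.TensorProduct.one_def, one_mul, map_sum] at h'
  rw [← h', map_sum]
  refine Finset.sum_congr rfl fun i _ => ?_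
  rw [mulBy_left_mul, twoFormPart_left_mul]
  congr 1
  have e := hϱ (b i)
  rw [eq_comm, neg_eq_iff_eq_neg] at e
  rw [e, map_neg, nabla_nabla]
  simp only [map_sum, twoFormPart_tmul]

theorem IsCurvature.comm (hϱ : IsCurvature P X ϱ) (hcl : IsClassical ϱ)
    (hX : ∀ i (b c : B), X i (b * c) = X i b * c + b * X i c)
    (i j : Fin n) (a : Pol n) (z : B) : z * curvComp ϱ i j a = curvComp ϱ i j a * z := by
  -- Expand [X_i, X_j](bz) twice: as a derivation of the product, and through F(b)F(z). The common
  -- term b [X_i, X_j](z) cancels, leaving ∑ bₖ z ϱ_ij(cₖ) = ∑ bₖ ϱ_ij(cₖ) z.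
  have hF : ∀ b, mulMid (curvComp ϱ i j) z (P.F b) = mulComp (curvComp ϱ i j) (P.F b) * z := by
    intro b
    have h1 := hϱ.commutator i j (b * z)
    have h2 := hϱ.commutator i j b
    have h3 := hϱ.commutator i j z
    rw [map_mul P.F, (curvComp_isPointDerivation hcl i j).mulComp_mul, P.counital,
      P.counital] at h1
    simp only [hX, map_add] at h1
    linear_combination (norm := noncomm_ring) h1 - h2 * z - b * h3
  -- Freeness replaces ∑ bₖ ⊗ cₖ by 1 ⊗ a, which turns `hF` into commutation of z with ϱ_ij(a).
  obtain ⟨m, q, b, h⟩ := P.free a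
  have h1 := congrArg (mulMid (curvComp ϱ i j) z) h
  have h2 := congrArg (mulComp (curvComp ϱ i j)) h
  rw [mulMid_tmul, one_mul, map_sum] at h1
  rw [mulComp_tmul, one_mul, map_sum] at h2
  rw [← h1, ← h2, Finset.sum_mul]
  refine Finset.sum_congr rfl fun m _ => ?_
  rw [mulMid_left_mul, mulComp_left_mul, hF, mul_assoc]

/-- The cyclic sum of [X_i, X_j] ∂_k f vanishes because X_i ∂_j f is symmetric in i, j; covariance
of ∂_k writes each commutator through the u_lk. -/
theorem IsCurvature.bianchi {τ : FrameStructure P} {S : IntegrableSystem τ}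
    {ϱ : Pol n →ₗ[ℂ] Hor n B} (hϱ : IsCurvature P S.X ϱ) (i j k m : Fin n) :
    curvComp ϱ i j (vecRep m k) + curvComp ϱ j k (vecRep m i) + curvComp ϱ k i (vecRep m j) = 0 := by
  have hcomm : ∀ (i j k : Fin n) (f : P.base), S.X i (S.X j (τ.d k f)) - S.X j (S.X i (τ.d k f)) =
      - ∑ l, τ.d l f * curvComp ϱ i j (vecRep l k) := by
    intro i j k f
    rw [hϱ.commutator, τ.covariant, map_sum]
    simp only [mulComp_tmul]
  have hsum : ∀ f : P.base, ∑ l, τ.d l f * (curvComp ϱ i j (vecRep l k) +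
      curvComp ϱ j k (vecRep l i) + curvComp ϱ k i (vecRep l j)) = 0 := by
    intro f
    have t : ∀ i j, S.X i (τ.d j f) = S.X j (τ.d i f) := fun i j =>
      sub_eq_zero.1 (S.torsionFree i j f)
    have h1 := hcomm i j k f
    have h2 := hcomm j k i f
    have h3 := hcomm k i j f
    rw [t k i, eq_comm, neg_eq_iff_eq_neg] at h2
    rw [t i j, t k j, eq_comm, neg_eq_iff_eq_neg] at h3
    rw [eq_comm, neg_eq_iff_eq_neg] at h1
    simp only [mul_add, Finset.sum_add_distrib]
    rw [h1, h2, h3, t j i]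
    abel
  obtain ⟨N, b, v, hbv⟩ := τ.nondegenerate
  -- The frame identity, inserted as a Kronecker delta, isolates the summand l = m.
  calc _ = ∑ l, (∑ α, b m α * τ.d l (v m α)) * (curvComp ϱ i j (vecRep l k) +
        curvComp ϱ j k (vecRep l i) + curvComp ϱ k i (vecRep l j)) := by
        simp only [hbv, ite_mul, one_mul, zero_mul, Finset.sum_ite_eq, Finset.mem_univ, if_true]
    _ = ∑ α, b m α * ∑ l, τ.d l (v m α) * (curvComp ϱ i j (vecRep l k) +
        curvComp ϱ j k (vecRep l i) + curvComp ϱ k i (vecRep l j)) := by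
        simp only [Finset.sum_mul, Finset.mul_sum, mul_assoc]
        exact Finset.sum_comm
    _ = 0 := by simp only [hsum, mul_zero, Finset.sum_const_zero]

end Curvature

/-! ### The Hodge operator and the Laplacian on functions -/

section Hodge

variable {n : ℕ}

theorem contractLeft_dualVec_extE_mul (k l : Fin n) (ω : Ext n) :
    CliffordAlgebra.contractLeft (dualVec (Pi.single k 1)) (extE l * ω) =
      (if k = l then (1 : ℂ) else 0) • ω -
        extE l * CliffordAlgebra.contractLeft (dualVec (Pi.single k 1)) ω := by
  rw [extE]
  erw [CliffordAlgebra.contractLeft_ι_mul]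
  congr 2
  simp [dualVec, Pi.single_apply, eq_comm]

theorem contraction_extE (k : Fin n) (ω : Ext n) :
    contraction n (extE k) ω = CliffordAlgebra.contractLeft (dualVec (Pi.single k 1)) ω := by
  rw [contraction, extE, ExteriorAlgebra.lift_ι_apply]
  rfl

theorem contraction_extE_list_prod {k : Fin n} {l : List (Fin n)} (h : k ∉ l) :
    contraction n (extE k) (l.map extE).prod = 0 := by
  induction l with
  | nil =>
    exact (contraction_extE k 1).trans
      (CliffordAlgebra.contractLeft_one (Q := (0 : QuadraticForm ℂ (Fin n → ℂ))) _)
  | cons i l ih =>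
    rw [List.map_cons, List.prod_cons, contraction_extE, contractLeft_dualVec_extE_mul,
      ← contraction_extE, ih fun h' => h (List.mem_cons_of_mem _ h'), mul_zero, sub_zero,
      if_neg fun e => h (List.mem_cons.2 (Or.inl e)), zero_smul]

theorem reverse_extE_mul (i : Fin n) (ω : Ext n) :
    CliffordAlgebra.reverse (extE i * ω) = CliffordAlgebra.reverse ω * extE i := by
  refine (CliffordAlgebra.reverse.map_mul _ _).trans ?_
  congr 1
  exact CliffordAlgebra.reverse_ι _

/-- Reversal makes the contraction by the first factor act first, so the factors are stripped off
from the left without signs. -/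
theorem contraction_reverse_list_prod {l : List (Fin n)} (h : l.Nodup) :
    contraction n (CliffordAlgebra.reverse ((l.map extE).prod : Ext n))
      ((l.map extE).prod : Ext n) = 1 := by
  induction l with
  | nil =>
    rw [List.map_nil, List.prod_nil]
    erw [CliffordAlgebra.reverse.map_one]
    rw [map_one (contraction n)]
    rfl
  | cons i l ih =>
    obtain ⟨hi, hl⟩ := List.nodup_cons.1 h
    rw [List.map_cons, List.prod_cons, reverse_extE_mul, map_mul (contraction n), Module.End.mul_apply,
      contraction_extE, contractLeft_dualVec_extE_mul, ← contraction_extE,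
      contraction_extE_list_prod hi, mul_zero,
      sub_zero, if_pos rfl, one_smul, ih hl]

theorem vol_eq (n : ℕ) : vol n = ((List.finRange n).map extE).prod := by
  rw [vol, ExteriorAlgebra.ιMulti_apply, List.ofFn_eq_map]
  rfl

theorem hodgeExt_apply (ω : Ext n) :
    hodgeExt n ω = contraction n (CliffordAlgebra.reverse ω) (vol n) := rfl

theorem hodgeExt_one : hodgeExt n 1 = vol n := by
  rw [hodgeExt_apply]
  erw [CliffordAlgebra.reverse.map_one]
  rw [map_one]
  rfl

theorem hodgeExt_vol : hodgeExt n (vol n) = 1 := by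
  rw [hodgeExt_apply, vol_eq]
  exact contraction_reverse_list_prod (List.nodup_finRange n)

theorem hodgeExt_extE (k : Fin n) :
    hodgeExt n (extE k) = CliffordAlgebra.contractLeft (dualVec (Pi.single k 1)) (vol n) := by
  rw [hodgeExt_apply, ← contraction_extE]
  congr 2
  exact CliffordAlgebra.reverse_ι _

theorem extE_mul_vol (k : Fin n) : extE k * vol n = 0 := by
  rw [vol, ExteriorAlgebra.ιMulti_apply]
  exact ExteriorAlgebra.ι_mul_prod_list (R := ℂ) (fun i : Fin n => (Pi.single i 1 : Fin n → ℂ)) k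

/-- Contracting e_l ∧ vol = 0 with e_k gives e_l ∧ ⋆e_k = δ_kl vol. -/
theorem hodgeExt_extE_mul_hodgeExt_extE (k l : Fin n) :
    hodgeExt n (extE l * hodgeExt n (extE k)) = if k = l then 1 else 0 := by
  have h := contractLeft_dualVec_extE_mul k l (vol n)
  rw [extE_mul_vol, map_zero, eq_comm, sub_eq_zero, ← hodgeExt_extE] at h
  rw [← h, map_smul, hodgeExt_vol]
  split_ifs <;> simp

variable {B : Type*} [Ring B] [Algebra ℂ B]

/-- In even dimension the degree-dependent sign disappears, and ∇† = -⋆∇⋆ in all degrees. -/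
theorem parity_pow_even (r : ℕ) : parity n B ^ (2 * r) = 1 := by
  have h : parity n B ^ 2 = 1 := by
    rw [pow_two, parity, Module.End.mul_eq_comp, ← LinearMap.lTensor_comp,
      ← AlgHom.comp_toLinearMap, CliffordAlgebra.involute_comp_involute]
    exact LinearMap.lTensor_id _ _
  rw [pow_mul, h, one_pow]

theorem nablaDag_one {r : ℕ} (X : Fin (2 * r) → B →ₗ[ℂ] B) (b : B) :
    nablaDag X (b ⊗ₜ[ℂ] 1) = 0 := by
  rw [nablaDag, parity_pow_even]
  simp [hodge, hodgeExt_one, nabla_tmul, extE_mul_vol]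

theorem nablaDag_extE {r : ℕ} (X : Fin (2 * r) → B →ₗ[ℂ] B) (b : B) (k : Fin (2 * r)) :
    nablaDag X (b ⊗ₜ[ℂ] extE k) = - X k b ⊗ₜ[ℂ] 1 := by
  rw [nablaDag, parity_pow_even]
  simp only [LinearMap.smul_apply, LinearMap.comp_apply, Module.End.one_apply, hodge,
    LinearMap.lTensor_tmul, nabla_tmul, map_sum, hodgeExt_extE_mul_hodgeExt_extE]
  rw [Finset.sum_eq_single k (by intro l _ hl; simp [Ne.symm hl]) (by simp)]
  simp

/-- On functions ∇† vanishes, so only ∇†∇ contributes. -/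
theorem laplacian_degZero {r : ℕ} (X : Fin (2 * r) → B →ₗ[ℂ] B) (b : B) (σ : Spinor r) :
    laplacian X (degZero (b ⊗ₜ[ℂ] σ)) = degZero (- ∑ k, X k (X k b) ⊗ₜ[ℂ] σ) := by
  simp only [laplacian, degZero, LinearMap.add_apply, LinearMap.comp_apply, LinearMap.rTensor_tmul,
    AlgHom.toLinearMap_apply, Algebra.TensorProduct.includeLeft_apply, nablaDag_one, nabla_tmul,
    mul_one, map_zero, TensorProduct.zero_tmul, zero_add, map_sum, nablaDag_extE, map_neg,
    TensorProduct.sum_tmul, TensorProduct.neg_tmul, Finset.sum_neg_distrib]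

end Hodge

/-! ### Products of gamma matrices -/

section Gamma

theorem sum_rotate {n : ℕ} {V : Type*} [AddCommGroup V] (f : Fin n → Fin n → Fin n → V) :
    ∑ i, ∑ j, ∑ k, f i j k = ∑ i, ∑ j, ∑ k, f k i j := by
  calc _ = ∑ j, ∑ i, ∑ k, f i j k := Finset.sum_comm
    _ = ∑ j, ∑ k, ∑ i, f i j k := Finset.sum_congr rfl fun _ _ => Finset.sum_comm

variable {n : ℕ} {M A : Type*} [AddCommGroup M] [Module ℂ M] [Ring A] [Algebra ℂ A]
  {g : Fin n → A}

/-- The symmetric part of Z meets the anticommutator and yields the trace. This serves both for D²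
and for the contracted curvature. -/
theorem sum_tmul_gamma_mul_gamma
    (hg : ∀ i j, g i * g j + g j * g i = algebraMap ℂ A (if i = j then 2 else 0))
    (Z : Fin n → Fin n → M) :
    ∑ i, ∑ j, Z i j ⊗ₜ[ℂ] (g i * g j) = ∑ i, Z i i ⊗ₜ[ℂ] (1 : A) +
      (1 / 2 : ℂ) • ∑ i, ∑ j, (Z i j - Z j i) ⊗ₜ[ℂ] (g i * g j) := by
  have h1 : ∑ i, ∑ j, Z j i ⊗ₜ[ℂ] (g i * g j) = (2 : ℂ) • ∑ i, Z i i ⊗ₜ[ℂ] (1 : A) -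
      ∑ i, ∑ j, Z i j ⊗ₜ[ℂ] (g i * g j) := by
    rw [Finset.sum_comm, Finset.smul_sum, ← Finset.sum_sub_distrib]
    refine Finset.sum_congr rfl fun i _ => ?_
    rw [eq_sub_iff_add_eq, ← Finset.sum_add_distrib]
    simp only [← TensorProduct.tmul_add, hg]
    rw [Finset.sum_eq_single i]
    · simp [Algebra.algebraMap_eq_smul_one]
    · intro j _ hj
      simp [hj]
    · simp
  simp only [TensorProduct.sub_tmul, Finset.sum_sub_distrib]
  rw [h1]
  module

theorem sum_delta_smul {V : Type*} [AddCommGroup V] [Module ℂ V] (c : Fin n) (f : Fin n → V) :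
    ∑ k, (if k = c then (2 : ℂ) else 0) • f k = (2 : ℂ) • f c := by
  simp only [ite_smul, zero_smul, Finset.sum_ite_eq', Finset.mem_univ, if_true]

variable {R : Fin n → Fin n → Fin n → Fin n → M}

theorem pair_symm_of_bianchi (h₁ : ∀ i j k l, R j i k l = - R i j k l)
    (h₂ : ∀ i j k l, R i j l k = - R i j k l)
    (hb : ∀ i j k l, R i j k l + R j k i l + R k i j l = 0) (i j k l : Fin n) :
    R i j k l = R k l i j := by
  have b2 := hb i j l k
  have b3 := hb j l k i
  have b4 := hb l k i j
  rw [h₂ i j k l] at b2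
  -- The rewrites bring the four cyclic identities to common index orders, so that their alternating
  -- sum is twice the claimed difference.
  rw [h₂ j l i k, h₁ k l j i, h₂ k l i j, h₁ j k l i, h₂ j k i l] at b3
  rw [h₁ k l i j, h₂ k i j l, h₁ l i k j, h₂ l i j k] at b4
  have : (2 : ℂ) • (R i j k l - R k l i j) = 0 := by
    calc _ = (R k i j l + R i j k l + R j k i l) - (-R i j k l + R j l i k + R l i j k) -
          (-R j l i k + - -R k l i j + - -R j k i l) +
          (-R k l i j + -R k i j l + - -R l i j k) := by module
      _ = 0 := by rw [hb k i j l, b2, b3, b4]; simp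
  exact sub_eq_zero.1 ((smul_eq_zero.1 this).resolve_left two_ne_zero)

/-- With S the left side and Q = ∑ R_ijil γ_j γ_l, reordering the gammas turns the two cyclic
permutations of S into S + 4Q and S + 2Q. Bianchi gives 3S + 6Q = 0, and pair symmetry reduces Q to
its trace. -/
theorem sum_tmul_gamma_of_bianchi
    (hg : ∀ i j, g i * g j + g j * g i = algebraMap ℂ A (if i = j then 2 else 0))
    (h₁ : ∀ i j k l, R j i k l = - R i j k l) (h₂ : ∀ i j k l, R i j l k = - R i j k l)
    (hb : ∀ i j k l, R i j k l + R j k i l + R k i j l = 0) :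
    ∑ i, ∑ j, ∑ k, ∑ l, R i j k l ⊗ₜ[ℂ] (g i * g j * g k * g l) =
      (-2 : ℂ) • ∑ i, ∑ j, R i j i j ⊗ₜ[ℂ] (1 : A) := by
  have hsw : ∀ i j, g i * g j = (if i = j then (2 : ℂ) else 0) • 1 - g j * g i := fun i j => by
    rw [eq_sub_iff_add_eq, hg, Algebra.algebraMap_eq_smul_one]
  have hdiag : ∀ i k l, R i i k l = 0 := fun i k l => by
    have := h₁ i i k l
    have h2 : (2 : ℂ) • R i i k l = 0 := by
      rw [two_smul]
      nth_rw 1 [this]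
      exact neg_add_cancel _
    exact (smul_eq_zero.1 h2).resolve_left two_ne_zero
  obtain ⟨S, hS⟩ : ∃ S, S = ∑ i, ∑ j, ∑ k, ∑ l, R i j k l ⊗ₜ[ℂ] (g i * g j * g k * g l) := ⟨_, rfl⟩
  obtain ⟨Q, hQ⟩ : ∃ Q, Q = ∑ i, ∑ j, ∑ l, R i j i l ⊗ₜ[ℂ] (g j * g l) := ⟨_, rfl⟩
  have hS1 : ∑ i, ∑ j, ∑ k, ∑ l, R j k i l ⊗ₜ[ℂ] (g i * g j * g k * g l) =
      S + (4 : ℂ) • Q := by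
    rw [sum_rotate fun i j k => ∑ l, R j k i l ⊗ₜ[ℂ] (g i * g j * g k * g l)]
    have e : ∀ i j k l, R i j k l ⊗ₜ[ℂ] (g k * g i * g j * g l) =
        R i j k l ⊗ₜ[ℂ] (g i * g j * g k * g l) +
          ((if k = i then (2 : ℂ) else 0) • R i j k l ⊗ₜ[ℂ] (g j * g l) -
          (if k = j then (2 : ℂ) else 0) • R i j k l ⊗ₜ[ℂ] (g i * g l)) := by
      intro i j k l
      have : g k * g i * g j = g i * g j * g k + ((if k = i then (2 : ℂ) else 0) • g j -
          (if k = j then (2 : ℂ) else 0) • g i) := by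
        rw [hsw k i, sub_mul, mul_assoc, hsw k j, mul_sub, smul_mul_assoc, one_mul, mul_smul_comm,
          mul_one, mul_assoc]
        abel
      rw [this, add_mul, sub_mul, smul_mul_assoc, smul_mul_assoc, TensorProduct.tmul_add,
        TensorProduct.tmul_sub, TensorProduct.tmul_smul, TensorProduct.tmul_smul]
    simp only [e, Finset.sum_add_distrib, Finset.sum_sub_distrib]
    rw [← hS]
    refine congrArg (S + ·) ?_
    have e1 : ∑ i, ∑ j, ∑ k, ∑ l, (if k = i then (2 : ℂ) else 0) • R i j k l ⊗ₜ[ℂ] (g j * g l) =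
        (2 : ℂ) • Q := by
      simp only [← Finset.smul_sum, sum_delta_smul, hQ]
    have e2 : ∑ i, ∑ j, ∑ k, ∑ l, (if k = j then (2 : ℂ) else 0) • R i j k l ⊗ₜ[ℂ] (g i * g l) =
        -((2 : ℂ) • Q) := by
      simp only [← Finset.smul_sum, sum_delta_smul]
      rw [Finset.sum_comm, hQ, ← smul_neg]
      simp only [← Finset.sum_neg_distrib, ← TensorProduct.neg_tmul, ← h₁]
    rw [e1, e2]
    module
  have hS2 : ∑ i, ∑ j, ∑ k, ∑ l, R k i j l ⊗ₜ[ℂ] (g i * g j * g k * g l) =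
      S + (2 : ℂ) • Q := by
    rw [← sum_rotate fun i j k => ∑ l, R i j k l ⊗ₜ[ℂ] (g j * g k * g i * g l)]
    have e : ∀ i j k l, R i j k l ⊗ₜ[ℂ] (g j * g k * g i * g l) =
        R i j k l ⊗ₜ[ℂ] (g i * g j * g k * g l) +
          (if k = i then (2 : ℂ) else 0) • R i j k l ⊗ₜ[ℂ] (g j * g l) := by
      intro i j k l
      -- Only one contraction survives here: the one between i and j would carry R_iikl = 0.
      by_cases hij : j = i
      · subst hij
        simp [hdiag]
      have : g j * g k * g i = g i * g j * g k + (if k = i then (2 : ℂ) else 0) • g j := by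
        rw [mul_assoc, hsw k i, mul_sub, mul_smul_comm, mul_one, ← mul_assoc, hsw j i, if_neg hij,
          zero_smul, zero_sub, neg_mul]
        abel
      rw [this, add_mul, smul_mul_assoc, TensorProduct.tmul_add, TensorProduct.tmul_smul]
    simp only [e, Finset.sum_add_distrib]
    rw [← hS]
    refine congrArg (S + ·) ?_
    simp only [← Finset.smul_sum, sum_delta_smul, hQ]
  have h0 : S + (S + (4 : ℂ) • Q) + (S + (2 : ℂ) • Q) = 0 := by
    rw [← hS1, ← hS2, hS]
    simp only [← Finset.sum_add_distrib, ← TensorProduct.add_tmul, hb, TensorProduct.zero_tmul,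
      Finset.sum_const_zero]
  have hQ' : Q = ∑ i, ∑ j, R i j i j ⊗ₜ[ℂ] (1 : A) := by
    rw [hQ]
    refine Finset.sum_congr rfl fun i _ => ?_
    -- By pair symmetry R_ijil is symmetric in j and l, so the antisymmetric part drops out.
    rw [sum_tmul_gamma_mul_gamma hg]
    have : ∀ j l, R i j i l - R i l i j = 0 := fun j l => by
      rw [pair_symm_of_bianchi h₁ h₂ hb i j i l, sub_self]
    simp [this]
  rw [← hQ', ← hS]
  have h3 : (3 : ℂ) • (S + (2 : ℂ) • Q) = 0 := by
    rw [← h0]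
    module
  rw [eq_neg_of_add_eq_zero_left ((smul_eq_zero.1 h3).resolve_left three_ne_zero), neg_smul]

end Gamma

/-! ### Points of `S(n)` separate elements of `B ⊗ 𝒮ₙ` -/

section Separation

variable {n : ℕ} {B : Type*} [Ring B] [Algebra ℂ B]

/-- In a basis of `B` the coordinates of a tensor are functions on the group, determined by their
values. -/
theorem eq_of_slice_ev {x y : B ⊗[ℂ] Pol n}
    (h : ∀ g : SpinG n, slice (ev g).toLinearMap x = slice (ev g).toLinearMap y) : x = y := by
  classical
  let b := Module.Basis.ofVectorSpace ℂ B
  refine (TensorProduct.equivFinsuppOfBasisLeft (N := Pol n) b).injective (Finsupp.ext fun i => ?_)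
  have key : ∀ (g : SpinG n) (z : B ⊗[ℂ] Pol n),
      ev g (TensorProduct.equivFinsuppOfBasisLeft b z i) =
        b.repr (slice (ev g).toLinearMap z) i := by
    intro g z
    induction z using TensorProduct.induction_on with
    | zero => simp
    | tmul c a =>
      rw [TensorProduct.equivFinsuppOfBasisLeft_apply_tmul_apply, slice_tmul]
      simp [mul_comm]
    | add z w hz hw => simp only [map_add, Finsupp.add_apply, hz, hw]
  exact Pol_ext fun g => by rw [key, key, h]

theorem slice_mul_one_tmul {A : Type*} [Ring A] [Algebra ℂ A] (f : A →ₐ[ℂ] ℂ) (x : B ⊗[ℂ] A)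
    (a : A) : slice f.toLinearMap (x * 1 ⊗ₜ[ℂ] a) = f a • slice f.toLinearMap x := by
  induction x using TensorProduct.induction_on with
  | zero => simp
  | tmul c d =>
    rw [Algebra.TensorProduct.tmul_mul_tmul, mul_one, slice_tmul, slice_tmul, smul_smul]
    simp [mul_comm]
  | add x y hx hy => rw [add_mul, map_add, hx, hy, map_add, smul_add]

theorem sum_slice_coord {ι V : Type*} [Fintype ι] [AddCommGroup V] [Module ℂ V]
    (b : Module.Basis ι ℂ V) (ψ : B ⊗[ℂ] V) : ∑ i, slice (b.coord i) ψ ⊗ₜ[ℂ] b i = ψ := by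
  induction ψ using TensorProduct.induction_on with
  | zero => simp
  | tmul c v =>
    simp only [slice_tmul, TensorProduct.smul_tmul, ← TensorProduct.tmul_sum,
      Module.Basis.coord_apply, b.sum_repr]
  | add ψ φ hψ hφ => simp only [map_add, TensorProduct.add_tmul, Finset.sum_add_distrib, hψ, hφ]

variable {V : Type*} [AddCommGroup V] [Module ℂ V]

/-- Apply an element of `B ⊗ End(V)` to `b ⊗ v`. -/
def applyTmul (b : B) (v : V) :
    B ⊗[ℂ] Module.End ℂ V →ₗ[ℂ] B ⊗[ℂ] V :=
  TensorProduct.map (LinearMap.mulLeft ℂ b) (LinearMap.applyₗ v)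

theorem applyTmul_tmul (b : B) (v : V) (c : B)
    (T : Module.End ℂ V) : applyTmul b v (c ⊗ₜ[ℂ] T) = (b * c) ⊗ₜ[ℂ] T v := by
  simp [applyTmul]

end Separation

/-! ### Curvature operator, square of the Dirac operator, and invariant spinors -/

section Spinors

variable {r : ℕ} {B : Type*} [Ring B] [Algebra ℂ B]

theorem gam_mul_add_swap (i j : Fin (2 * r)) : gam i * gam j + gam j * gam i =
    algebraMap ℂ (Module.End ℂ (Spinor r)) (if i = j then 2 else 0) := by
  rw [gam, gam, ← map_mul, ← map_mul, ← map_add, clE_mul_add_swap, AlgHom.commutes]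
  refine LinearMap.ext fun v => ?_
  have h : ∀ c : ℝ, algebraMap ℝ (Module.End ℂ (Spinor r)) c v = (c : ℂ) • v := by
    intro c
    rw [Algebra.algebraMap_eq_smul_one, LinearMap.smul_apply, Module.End.one_apply]
    exact (algebraMap_smul ℂ c v).symm
  rw [Module.algebraMap_end_apply]
  refine (h _).trans ?_
  split_ifs <;> simp

theorem counit_spinRep (J I : Finset (Fin r)) :
    counit (spinRep J I) = if J = I then 1 else 0 := by
  change (sig r).coord J (cliffAct r ((1 : SpinG (2 * r)) : Cl (2 * r)) (sig r I)) = _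
  rw [OneMemClass.coe_one, map_one, Module.End.one_apply, Module.Basis.coord_apply,
    Module.Basis.repr_self, Finsupp.single_apply]
  simp only [eq_comm]

theorem IsCurvCoeff.curvComp_spinRep {ϱ : Pol (2 * r) →ₗ[ℂ] Hor (2 * r) B}
    {R : Fin (2 * r) → Fin (2 * r) → Fin (2 * r) → Fin (2 * r) → B} (hR : IsCurvCoeff ϱ R)
    (i j : Fin (2 * r)) (J I : Finset (Fin r)) : curvComp ϱ i j (spinRep J I) =
      (1 / 4 : ℂ) • ∑ k, ∑ l, (sig r).coord J (gam k (gam l (sig r I))) • R i j k l := by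
  rw [hR.2]
  have : ∀ k l, genPi k l (spinRep J I) • R i j k l =
      (1 / 2 : ℂ) • (sig r).coord J (gam k (gam l (sig r I))) • R i j k l := by
    intro k l
    -- `genPi k k` is zero while γ_k γ_k = 1; the two agree after multiplication by R_ijkk, which
    -- vanishes by antisymmetry.
    by_cases h : k = l
    · subst h
      have h2 : (2 : ℂ) • R i j k k = 0 := by
        rw [two_smul]
        nth_rw 1 [hR.1 i j k k]
        exact neg_add_cancel _
      rw [(smul_eq_zero.1 h2).resolve_left two_ne_zero, smul_zero, smul_zero, smul_zero]
    · rw [genPi_spinRep h, mul_smul]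
  simp only [this]
  simp only [← Finset.smul_sum]
  rw [smul_smul]
  norm_num

/-- Summing over J reassembles γ_k γ_l σ_I from its coordinates. The constant is -1/2 times the 1/4
from `IsCurvCoeff.curvComp_spinRep`. -/
theorem IsCurvCoeff.curvOp_eq {ϱ : Pol (2 * r) →ₗ[ℂ] Hor (2 * r) B}
    {R : Fin (2 * r) → Fin (2 * r) → Fin (2 * r) → Fin (2 * r) → B} (hR : IsCurvCoeff ϱ R)
    (ψ : B ⊗[ℂ] Spinor r) : curvOp ϱ ψ = (-(1 / 8) : ℂ) • ∑ I,
      applyTmul (slice ((sig r).coord I) ψ) (sig r I)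
        (∑ i, ∑ j, ∑ k, ∑ l, R i j k l ⊗ₜ[ℂ] (gam i * gam j * gam k * gam l)) := by
  have h : ∀ i j I, ∑ J, (slice ((sig r).coord I) ψ * curvComp ϱ i j (spinRep J I)) ⊗ₜ[ℂ]
      gam i (gam j (sig r J)) = (1 / 4 : ℂ) • ∑ k, ∑ l, (slice ((sig r).coord I) ψ * R i j k l)
        ⊗ₜ[ℂ] gam i (gam j (gam k (gam l (sig r I)))) := by
    intro i j I
    have e : ∀ k l, (slice ((sig r).coord I) ψ * R i j k l) ⊗ₜ[ℂ]
        gam i (gam j (gam k (gam l (sig r I)))) =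
        ∑ J, (sig r).coord J (gam k (gam l (sig r I))) •
          (slice ((sig r).coord I) ψ * R i j k l) ⊗ₜ[ℂ] gam i (gam j (sig r J)) := by
      intro k l
      conv_lhs => rw [← (sig r).sum_repr (gam k (gam l (sig r I)))]
      simp only [map_sum, map_smul, TensorProduct.tmul_sum, TensorProduct.tmul_smul,
        Module.Basis.coord_apply]
    simp only [e, hR.curvComp_spinRep, mul_smul_comm, Finset.mul_sum, ← TensorProduct.smul_tmul',
      TensorProduct.sum_tmul]
    rw [← Finset.smul_sum, Finset.sum_comm]
    congr 1
    exact Finset.sum_congr rfl fun k _ => Finset.sum_comm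
  simp only [curvOp, h, map_sum, applyTmul_tmul, Module.End.mul_apply, ← Finset.smul_sum, smul_smul]
  congr 1
  · norm_num
  · symm
    rw [Finset.sum_comm]
    refine Finset.sum_congr rfl fun i _ => ?_
    rw [Finset.sum_comm]

theorem IsCurvCoeff.curvOp_eq_scalarCurv {ϱ : Pol (2 * r) →ₗ[ℂ] Hor (2 * r) B}
    {R : Fin (2 * r) → Fin (2 * r) → Fin (2 * r) → Fin (2 * r) → B} (hR : IsCurvCoeff ϱ R)
    (h₁ : ∀ i j k l, R j i k l = - R i j k l)
    (hb : ∀ i j k l, R i j k l + R j k i l + R k i j l = 0)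
    (hc : ∀ i j k l, R i j k l ∈ Subalgebra.center ℂ B) (ψ : B ⊗[ℂ] Spinor r) :
    curvOp ϱ ψ = (1 / 4 : ℂ) • (scalarCurv R • ψ) := by
  rw [hR.curvOp_eq, sum_tmul_gamma_of_bianchi gam_mul_add_swap h₁ hR.1 hb]
  have hs : ∑ i, ∑ j, R i j i j ⊗ₜ[ℂ] (1 : Module.End ℂ (Spinor r)) = scalarCurv R ⊗ₜ[ℂ] 1 := by
    simp only [scalarCurv, TensorProduct.sum_tmul]
  have hρ : scalarCurv R ∈ Subalgebra.center ℂ B :=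
    sum_mem fun i _ => sum_mem fun j _ => hc i j i j
  rw [Subalgebra.mem_center_iff] at hρ
  simp only [hs, map_smul, applyTmul_tmul, hρ, Module.End.one_apply, ← Finset.smul_sum, smul_smul]
  conv_rhs => rw [← sum_slice_coord (sig r) ψ]
  simp only [Finset.smul_sum, TensorProduct.smul_tmul', smul_eq_mul]
  norm_num

/-- The signs come from (-i)² = -1. -/
theorem dirac_dirac (X : Fin (2 * r) → B →ₗ[ℂ] B) (b : B) (σ : Spinor r) :
    dirac X (dirac X (b ⊗ₜ[ℂ] σ)) = - ∑ i, X i (X i b) ⊗ₜ[ℂ] σ -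
      (1 / 2 : ℂ) • ∑ i, ∑ j, (X i (X j b) - X j (X i b)) ⊗ₜ[ℂ] gam i (gam j σ) := by
  have h := congrArg (applyTmul 1 σ) (sum_tmul_gamma_mul_gamma gam_mul_add_swap
    fun i j => X i (X j b))
  simp only [map_sum, map_add, map_smul, applyTmul_tmul, one_mul, Module.End.mul_apply,
    Module.End.one_apply] at h
  have h' : dirac X (dirac X (b ⊗ₜ[ℂ] σ)) =
      - ∑ i, ∑ j, X i (X j b) ⊗ₜ[ℂ] gam i (gam j σ) := by
    simp only [dirac, LinearMap.smul_apply, LinearMap.sum_apply, TensorProduct.map_tmul, map_smul,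
      map_sum, ← Finset.smul_sum, smul_smul]
    rw [neg_mul_neg, Complex.I_mul_I, neg_one_smul, Finset.sum_comm]
  rw [h', h]
  abel

variable [StarRing B] [StarModule ℂ B]

/-- At each point of the group this is the σ_J coordinate of the invariance condition, and points
separate. -/
theorem spinorFields_equivariant {P : SpinBundle (2 * r) B} {ψ : B ⊗[ℂ] Spinor r}
    (hψ : ψ ∈ spinorFields P) (J : Finset (Fin r)) :
    ∑ I, P.F (slice ((sig r).coord I) ψ) * 1 ⊗ₜ[ℂ] spinRep J I =
      slice ((sig r).coord J) ψ ⊗ₜ[ℂ] 1 := by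
  refine eq_of_slice_ev fun g => ?_
  rw [map_sum, slice_tmul]
  simp only [slice_mul_one_tmul]
  have h := hψ g
  conv_rhs => rw [← h, ← sum_slice_coord (sig r) ψ]
  simp only [map_sum, TensorProduct.map_tmul, slice_tmul, AlgHom.toLinearMap_apply, map_one,
    one_smul]
  rfl

/-- The curvature acts on the components of a spinor field through the spin representation. -/
theorem mulComp_spinorField {P : SpinBundle (2 * r) B} {ψ : B ⊗[ℂ] Spinor r}
    (hψ : ψ ∈ spinorFields P) {D : Pol (2 * r) →ₗ[ℂ] B} (hD : IsPointDerivation D)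
    (J : Finset (Fin r)) :
    mulComp D (P.F (slice ((sig r).coord J) ψ)) =
      - ∑ I, slice ((sig r).coord I) ψ * D (spinRep J I) := by
  -- Differentiate the invariance condition at the unit: D(1) = 0 and ε(U_JI) = δ_JI, so no inverse
  -- of U enters.
  have h := congrArg (mulComp D) (spinorFields_equivariant hψ J)
  rw [map_sum, mulComp_tmul, hD.map_one, mul_zero] at h
  have hmid : ∀ (c : ℂ) (x : B ⊗[ℂ] Pol (2 * r)), mulMid D (c • 1) x = c • mulComp D x := by
    intro c x
    induction x using TensorProduct.induction_on with
    | zero => simp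
    | tmul b a => rw [mulMid_tmul, mulComp_tmul, mul_smul_comm, mul_one, smul_mul_assoc]
    | add x y hx hy => rw [map_add, hx, hy, map_add, smul_add]
  simp only [hD.mulComp_mul, P.counital, mulComp_tmul, one_mul, slice_tmul,
    AlgHom.toLinearMap_apply, hmid, counit_spinRep, Finset.sum_add_distrib] at h
  simp only [ite_smul, one_smul, zero_smul, Finset.sum_ite_eq, Finset.mem_univ, if_true] at h
  rw [add_comm] at h
  exact eq_neg_of_add_eq_zero_left h

end Spinors

end QSpin

end

/-! ### The Lichnerowicz formula -/

theorem mainTheorem2 {r : ℕ} {B : Type*} [Ring B] [StarRing B] [Algebra ℂ B] [StarModule ℂ B]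
    (P : QSpin.SpinBundle (2 * r) B) (τ : QSpin.FrameStructure P) (S : QSpin.IntegrableSystem τ)
    (ϱ : QSpin.Pol (2 * r) →ₗ[ℂ] QSpin.Hor (2 * r) B)
    (hϱ : QSpin.IsCurvature P S.X ϱ) (hcl : QSpin.IsClassical ϱ) :
    (∀ i j, QSpin.curvComp ϱ j i = - QSpin.curvComp ϱ i j) ∧
    (∀ a, ϱ a = (1 / 2 : ℂ) • ∑ i, ∑ j,
      QSpin.curvComp ϱ i j a ⊗ₜ[ℂ] (QSpin.extE i * QSpin.extE j)) ∧
    (∃! R, QSpin.IsCurvCoeff ϱ R) ∧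
    ∀ R, QSpin.IsCurvCoeff ϱ R →
      (∀ i j k l, R i j k l ∈ Subalgebra.center ℂ B) ∧
      ∀ ψ ∈ QSpin.spinorFields P,
        QSpin.curvOp ϱ ψ = (1 / 4 : ℂ) • (QSpin.scalarCurv R • ψ) ∧
        QSpin.degZero (QSpin.dirac S.X (QSpin.dirac S.X ψ)) =
          QSpin.laplacian S.X (QSpin.degZero ψ) +
            QSpin.degZero ((1 / 4 : ℂ) • (QSpin.scalarCurv R • ψ)) := by
  have hD : ∀ i j, QSpin.IsPointDerivation (QSpin.curvComp ϱ i j) := fun i j =>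
    QSpin.curvComp_isPointDerivation hcl i j
  -- Evaluating at u_kl leaves R_ijkl - R_ijlk = 2 R_ijkl under the factor 1/2.
  have huniq : ∀ R, QSpin.IsCurvCoeff ϱ R →
      ∀ i j k l, R i j k l = QSpin.curvComp ϱ i j (QSpin.vecRep k l) := by
    intro R hR i j k l
    rw [hR.2]
    simp only [QSpin.genPi_vecRep, sub_smul, Finset.sum_sub_distrib, mul_ite, mul_one, mul_zero,
      ite_smul, one_smul, zero_smul]
    simp [hR.1 i j k l]
    module
  refine ⟨fun i j => QSpin.curvComp_swap ϱ i j, hϱ.eq_twoForm, ?_, ?_⟩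
  · refine ⟨fun i j k l => QSpin.curvComp ϱ i j (QSpin.vecRep k l), ⟨?_, ?_⟩, ?_⟩
    · exact fun i j k l => (hD i j).antisymm k l
    · exact fun i j a => (hD i j).eq_sum_genPi a
    · intro R hR
      funext i j k l
      exact huniq R hR i j k l
  intro R hR
  have hR' := huniq R hR
  have hc : ∀ i j k l, R i j k l ∈ Subalgebra.center ℂ B := by
    intro i j k l
    rw [Subalgebra.mem_center_iff]
    intro z
    rw [hR']
    exact hϱ.comm hcl S.leibniz i j _ z
  refine ⟨hc, fun ψ hψ => ?_⟩
  have h₁ : ∀ i j k l, R j i k l = - R i j k l := by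
    intro i j k l
    rw [hR', hR', QSpin.curvComp_swap ϱ i j, LinearMap.neg_apply]
  -- `bianchi` yields the identity with the last two indices exchanged, that is, up to an overall
  -- sign.
  have hb : ∀ i j k l, R i j k l + R j k i l + R k i j l = 0 := by
    intro i j k l
    have := hϱ.bianchi i j k l
    rw [← hR', ← hR', ← hR', hR.1 i j k l, hR.1 j k i l, hR.1 k i j l] at this
    rw [← neg_eq_zero, ← this]
    abel
  have hop := hR.curvOp_eq_scalarCurv h₁ hb hc ψ
  refine ⟨hop, ?_⟩
  have hlap : QSpin.laplacian S.X (QSpin.degZero ψ) = QSpin.degZero (∑ I,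
      -∑ k, S.X k (S.X k (QSpin.slice ((QSpin.sig r).coord I) ψ)) ⊗ₜ[ℂ] QSpin.sig r I) := by
    conv_lhs => rw [← QSpin.sum_slice_coord (QSpin.sig r) ψ]
    rw [map_sum, map_sum, map_sum]
    exact Finset.sum_congr rfl fun I _ => QSpin.laplacian_degZero S.X _ _
  rw [← hop, hlap, ← map_add]
  congr 1
  conv_lhs => rw [← QSpin.sum_slice_coord (QSpin.sig r) ψ]
  rw [map_sum, map_sum]
  -- The minus sign in the commutator formula cancels the one from invariance, so the commutator
  -- term becomes the defining sum of the curvature operator; what remains is reordering sums.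
  simp only [QSpin.dirac_dirac, hϱ.commutator, QSpin.mulComp_spinorField hψ (hD _ _), neg_neg,
    Finset.sum_sub_distrib]
  rw [sub_eq_add_neg]
  congr 1
  rw [QSpin.curvOp, neg_smul, ← Finset.smul_sum, Finset.sum_comm]
  congr 2
  refine Finset.sum_congr rfl fun i _ => ?_
  rw [Finset.sum_comm]
  refine Finset.sum_congr rfl fun j _ => ?_
  rw [Finset.sum_comm]
  simp only [TensorProduct.sum_tmul]
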